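/- **Setting.** Let $S$ be a finite-level system with Hamiltonian $H_S=\sum_i\epsilon_i|\epsilon_i\rangle\langle\epsilon_i|$ (degeneracies allowed) and let $W$ be the weight, with Hilbert space $L^2(\mathbb R)$, Hamiltonian $(H_W\varphi)(E)=E\,\varphi(E)$ and displacements $(\Gamma_a\varphi)(E)=(e^{-ia\Delta_W}\varphi)(E)=\varphi(E-a)$. For a density matrix $\rho$ of $S$ and a unitary $V$ of $S$ put $W_V=H_S-V^\dagger H_SV$ and define the ergotropy $R(\rho)=\max_V \mathrm{Tr}[W_V\rho]$, the incoherent ergotropy $R_I(\rho)=\max\{\mathrm{Tr}[W_V\rho] : [W_V,H_S]=0\}$, and the coherent ergotropy $R_C(\rho)=R(\rho)-R_I(\rho)$. For density operators $\rho_S$ of $S$ and $\rho_W$ of $W$, the control-marginal state is $\sigma_S=\mathrm{Tr}_W[\mathsf S(\rho_S\otimes\rho_W)\mathsf S^\dagger]$, where $\mathsf S=e^{-iH_S\otimes\Delta_W}=\sum_i|\epsilon_i\rangle\langle\epsilon_i|\otimes\Gamma_{\epsilon_i}$. Let $U$ be a unitary on $\mathbb C^n\otimes L^2(\mathbb R)$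 with $[U,H_S+H_W]=0$ and $[U,\Delta_W]=0$ (in the sense of commuting with the unitary groups generated by $H_S+H_W$ and $\Delta_W$). The initial and final energy dispersions $\sigma_E^{(i)},\sigma_E^{(f)}\in[0,\infty]$ are the standard deviations of the energy distribution of $H_W$ in the states $\rho_W$ and $\mathrm{Tr}_S[U(\rho_S\otimes\rho_W)U^\dagger]$ respectively. **Corollary.** Suppose that $\rho_S$ has positive coherent ergotropy, $R_C(\rho_S)>0$. 1. If the total ergotropy is unlocked, i.e. $R(\rho_S)=R(\sigma_S)$, then $\sigma_E^{(i)}=\sigma_E^{(f)}=\infty$, for every admissible $U$. 2. More generally, let $\rho_W^{(k)}$ be any sequence of density operators of the weight, with control-marginal states $\sigma_S^{(k)}$, and let $U_k$ be any sequence of admissible unitaries. If the total ergotropy is unlocked in the limit, i.e. $R(\sigma_S^{(k)})\to R(\rho_S)$ as $k\to\infty$, then the initial and final dispersions diverge: $\sigma_E^{(i,k)}\to\infty$ and $\sigma_E^{(f,k)}\to\infty$. -/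

import Mathlib

open scoped Matrix ENNReal InnerProductSpace ComplexOrder Topology

namespace QuantumWeight

noncomputable section

/-! ### The finite-level system

The Hilbert space of the system is `ℂⁿ`, written in an orthonormal basis of energy eigenvectors. The
energies `ε i` are arbitrary real numbers (degeneracies are allowed). -/

section System

variable {n : Type*} [Fintype n] [DecidableEq n]

/-- The system Hamiltonian `H_S = ∑ i, ε i |ε i⟩⟨ε i|`. -/
def systemHamiltonian (ε : n → ℝ) : Matrix n n ℂ :=
  Matrix.diagonal fun i => (ε i : ℂ)

/-- The work operator `W_S = H_S - V† H_S V` of a unitary `V` of the system. -/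
def workOperator (ε : n → ℝ) (V : Matrix n n ℂ) : Matrix n n ℂ :=
  systemHamiltonian ε - Vᴴ * systemHamiltonian ε * V

/-- A density matrix of the system. -/
structure IsDensityMatrix (ρ : Matrix n n ℂ) : Prop where
  posSemidef : ρ.PosSemidef
  trace_eq_one : ρ.trace = 1

/-- The ergotropy `R(ρ)`: the maximum of `Tr[W_S ρ]` over all unitaries of the system. -/
def ergotropy (ε : n → ℝ) (ρ : Matrix n n ℂ) : ℝ :=
  ⨆ V : Matrix.unitaryGroup n ℂ, ((workOperator ε (V : Matrix n n ℂ) * ρ).trace).re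

/-- The incoherent ergotropy `R_I(ρ)`: the maximum of `Tr[W_S ρ]` over the incoherent unitaries,
those whose work operator commutes with `H_S`. (If the energies are pairwise distinct, these are
exactly the unitaries that permute the energy eigenstates up to phases.) -/
def incoherentErgotropy (ε : n → ℝ) (ρ : Matrix n n ℂ) : ℝ :=
  ⨆ V : {V : Matrix.unitaryGroup n ℂ //
      Commute (workOperator ε (V : Matrix n n ℂ)) (systemHamiltonian ε)},
    ((workOperator ε (V.1 : Matrix n n ℂ) * ρ).trace).re

/-- The coherent ergotropy `R_C(ρ) = R(ρ) - R_I(ρ)`. -/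
def coherentErgotropy (ε : n → ℝ) (ρ : Matrix n n ℂ) : ℝ :=
  ergotropy ε ρ - incoherentErgotropy ε ρ

end System

/-! ### The weight -/

/-- The Hilbert space `L²(ℝ)` of the weight in the energy representation: the Hamiltonian `H_W` is
multiplication by the variable `E`. -/
abbrev WeightSpace : Type := MeasureTheory.Lp ℂ 2 (MeasureTheory.volume : MeasureTheory.Measure ℝ)

/-- The displacement operator `Γ_a = exp(-i a Δ_W)`, `(Γ_a φ)(E) = φ(E - a)`, so that
`Γ_a |E⟩ = |E + a⟩` and `Γ_a† H_W Γ_a = H_W + a`. -/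
def displacement (a : ℝ) : WeightSpace →L[ℂ] WeightSpace :=
  (MeasureTheory.Lp.compMeasurePreservingₗᵢ ℂ (fun E : ℝ => E - a)
    (MeasureTheory.measurePreserving_sub_right MeasureTheory.volume a)).toContinuousLinearMap

theorem displacement_apply (a : ℝ) (φ : WeightSpace) :
    displacement a φ =ᵐ[MeasureTheory.volume] fun E => φ (E - a) :=
  MeasureTheory.Lp.coeFn_compMeasurePreserving φ
    (MeasureTheory.measurePreserving_sub_right MeasureTheory.volume a)

theorem memLp_phase (s : ℝ) :
    MeasureTheory.MemLp (fun E : ℝ => Complex.exp (Complex.I * s * E)) ∞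
      MeasureTheory.volume := by
  refine MeasureTheory.memLp_top_of_bound
    (by fun_prop : Continuous fun E : ℝ => Complex.exp (Complex.I * s * E)).aestronglyMeasurable
    1 (Filter.Eventually.of_forall fun E => ?_)
  simp [Complex.norm_exp]

/-- The free evolution `exp(i s H_W)`: multiplication by `E ↦ exp(i s E)`. -/
def weightPhase (s : ℝ) : WeightSpace →L[ℂ] WeightSpace :=
  (ContinuousLinearMap.lsmul ℂ ℂ).holderL MeasureTheory.volume ∞ 2 2 (memLp_phase s).toLp

theorem weightPhase_apply (s : ℝ) (φ : WeightSpace) :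
    weightPhase s φ =ᵐ[MeasureTheory.volume]
      fun E => Complex.exp (Complex.I * s * E) * φ E := by
  have h1 := (ContinuousLinearMap.lsmul ℂ ℂ).coeFn_holder (r := 2) (memLp_phase s).toLp φ
  filter_upwards [h1, (memLp_phase s).coeFn_toLp] with E h1 h2
  rw [← h2]
  exact h1

/-- The index set of a fixed orthonormal basis of the weight space. -/
def weightIndex : Set WeightSpace := (exists_hilbertBasis ℂ WeightSpace).choose

/-- A fixed orthonormal (Hilbert) basis of the weight space, used to write down traces. -/
def weightBasis : HilbertBasis weightIndex ℂ WeightSpace :=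
  (exists_hilbertBasis ℂ WeightSpace).choose_spec.choose

/-- The trace `Tr A = ∑ k, ⟨b k, A b k⟩` of a trace-class operator on the weight space. -/
def weightTrace (A : WeightSpace →L[ℂ] WeightSpace) : ℂ :=
  ∑' k, ⟪weightBasis k, A (weightBasis k)⟫_ℂ

/-- A density operator of the weight: a positive operator with trace one. -/
structure IsDensityOperator (ρ : WeightSpace →L[ℂ] WeightSpace) : Prop where
  isPositive : ρ.IsPositive
  hasSum_trace : HasSum (fun k => ⟪weightBasis k, ρ (weightBasis k)⟫_ℂ) 1

/-- The positive square root of a positive operator on a complex Hilbert space. -/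
def operatorSqrt {H : Type*} [NormedAddCommGroup H] [InnerProductSpace ℂ H] [CompleteSpace H]
    (A : H →L[ℂ] H) : H →L[ℂ] H :=
  CFC.sqrt A

/-- The energy distribution of a weight state `ρ`, i.e. the measure
`B ↦ Tr[√ρ 1_B(H_W) √ρ] = Tr[ρ 1_B(H_W)]`. Its density is
`f(E) = ⟨E|ρ|E⟩ = ∑ k, |(√ρ b k)(E)|²`. -/
def energyDistribution (ρ : WeightSpace →L[ℂ] WeightSpace) : MeasureTheory.Measure ℝ :=
  MeasureTheory.Measure.sum fun k =>
    MeasureTheory.volume.withDensity fun E => ‖(operatorSqrt ρ (weightBasis k)) E‖ₑ ^ 2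

/-- The energy dispersion `σ_E ∈ [0, ∞]`: the standard deviation of the energy distribution. It is
`∞` exactly when the energy distribution has an infinite second moment. -/
def energyDispersion (ρ : WeightSpace →L[ℂ] WeightSpace) : ℝ≥0∞ :=
  (ProbabilityTheory.evariance (fun E : ℝ => E) (energyDistribution ρ)) ^ (1 / 2 : ℝ)

/-! ### System and weight together

Operators on `ℂⁿ ⊗ L²(ℝ) ≅ L²(ℝ)ⁿ` are `n × n` matrices of operators on `L²(ℝ)`; the entry `A i j` is
`⟨ε i| A |ε j⟩`. Product and adjoint are those of matrices over the star ring of operators. -/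

section Composite

variable {n : Type*} [Fintype n] [DecidableEq n]

/-- Operators on the composite Hilbert space `ℂⁿ ⊗ L²(ℝ)`. -/
abbrev CompositeOperator (n : Type*) : Type _ := Matrix n n (WeightSpace →L[ℂ] WeightSpace)

/-- The product operator `A ⊗ B`. -/
def tensor (A : Matrix n n ℂ) (B : WeightSpace →L[ℂ] WeightSpace) : CompositeOperator n :=
  Matrix.of fun i j => A i j • B

/-- The partial trace over the system, `Tr_S A = ∑ i, ⟨ε i| A |ε i⟩`. -/
def partialTraceSystem (A : CompositeOperator n) : WeightSpace →L[ℂ] WeightSpace :=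
  ∑ i, A i i

/-- The partial trace over the weight, `⟨ε i| Tr_W A |ε j⟩ = Tr ⟨ε i| A |ε j⟩`. -/
def partialTraceWeight (A : CompositeOperator n) : Matrix n n ℂ :=
  Matrix.of fun i j => weightTrace (A i j)

/-- The operator `S = exp(-i H_S ⊗ Δ_W) = ∑ i, |ε i⟩⟨ε i| ⊗ Γ_{ε i}`. -/
def controlOperator (ε : n → ℝ) : CompositeOperator n :=
  Matrix.diagonal fun i => displacement (ε i)

/-- The control-marginal state `σ_S = Tr_W[S (ρ_S ⊗ ρ_W) S†]`. -/
def controlMarginal (ε : n → ℝ) (ρS : Matrix n n ℂ) (ρW : WeightSpace →L[ℂ] WeightSpace) :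
    Matrix n n ℂ :=
  partialTraceWeight (controlOperator ε * tensor ρS ρW * star (controlOperator ε))

/-- The total free evolution `exp(i s (H_S + H_W))`. -/
def freeEvolution (ε : n → ℝ) (s : ℝ) : CompositeOperator n :=
  Matrix.diagonal fun i => Complex.exp (Complex.I * s * ε i) • weightPhase s

/-- The admissible work-extraction unitaries: `[U, H_S + H_W] = 0` (energy conservation) and
`[U, Δ_W] = 0` (translation invariance). The commutators with the unbounded self-adjoint generators
are expressed through the unitary groups that they generate. -/
structure IsWorkExtraction (ε : n → ℝ) (U : CompositeOperator n) : Prop where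
  mem_unitary : U ∈ unitary (CompositeOperator n)
  energy_conserving : ∀ s : ℝ, Commute U (freeEvolution ε s)
  translation_invariant : ∀ a : ℝ, Commute U (tensor 1 (displacement a))

/-- The final state `Tr_S[U (ρ_S ⊗ ρ_W) U†]` of the weight. -/
def finalWeightState (U : CompositeOperator n) (ρS : Matrix n n ℂ)
    (ρW : WeightSpace →L[ℂ] WeightSpace) : WeightSpace →L[ℂ] WeightSpace :=
  partialTraceSystem (U * tensor ρS ρW * star U)

end Composite

end

end QuantumWeight

/-!
For a unitary `V` of the system, `R(ρ_S) - Tr[W_V σ_S]` is the expectation in `ρ_W` of an operator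
`X = ∑ a, c a • Γ_a` that combines displacements by energy gaps. By Birkhoff's theorem `X` is
positive, and `|c 0| ≥ R_C(ρ_S)`, because `c 0` only sees the dephased state of the system.

Conjugation with the phases `exp(i j τ H_W)` multiplies `c a` by `exp(-i j τ a)`, so that `c 0 • φ`
is recovered by interpolation from the vectors `X exp(i j τ H_W) φ`, and these cannot all be small.
The conjugates `X_j` of the normalised `X` commute, hence the product of the contractions
`(1 - X_j) ^ J` tends to zero in norm as `J → ∞`. If the energy of `φ` is concentrated in an
interval that is short compared with `1 / τ`, the phases act on `φ` almost as scalars; if moreover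
`X φ` were small, all factors of the product would almost fix `φ`. Since `τ` can be taken as small
as we like, every interval length is eventually covered, at the cost of a weaker lower bound on
`⟨X⟩`.

Thus a bounded dispersion forces a loss of ergotropy bounded away from zero, by Chebyshev's
inequality. The final dispersion is treated in the same way: `U` preserves the distribution of
`H_S + H_W`, so the energy distribution of the weight is spread by at most `2 ∑ i, |ε i|`.
-/

namespace QuantumWeight

open MeasureTheory Filter

noncomputable section

section Commuting

variable {𝕜 H : Type*} [NontriviallyNormedField 𝕜] [NormedAddCommGroup H] [NormedSpace 𝕜 H]

theorem norm_pow_apply_le (A : H →L[𝕜] H) (J : ℕ) (φ : H) : ‖(A ^ J) φ‖ ≤ ‖A‖ ^ J * ‖φ‖ := by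
  induction J with
  | zero => simp
  | succ J ih =>
    rw [pow_succ', mul_apply_eq_comp, pow_succ', mul_assoc]
    exact A.le_opNorm_of_le ih

theorem norm_pow_le_one {A : H →L[𝕜] H} (hA : ‖A‖ ≤ 1) (J : ℕ) : ‖A ^ J‖ ≤ 1 :=
  ContinuousLinearMap.opNorm_le_bound _ zero_le_one fun φ =>
    (norm_pow_apply_le A J φ).trans (by gcongr; exact pow_le_one₀ (norm_nonneg A) hA)

theorem norm_sub_mul_apply_le {A : H →L[𝕜] H} (hA : ‖A‖ ≤ 1) (B : H →L[𝕜] H) (φ : H) :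
    ‖φ - (A * B) φ‖ ≤ ‖φ - A φ‖ + ‖φ - B φ‖ :=
  calc ‖φ - (A * B) φ‖ = ‖(φ - A φ) + A (φ - B φ)‖ := by simp
    _ ≤ ‖φ - A φ‖ + ‖A (φ - B φ)‖ := norm_add_le _ _
    _ ≤ ‖φ - A φ‖ + ‖φ - B φ‖ := by gcongr; simpa using A.le_of_opNorm_le hA (φ - B φ)

theorem norm_sub_pow_apply_le {A : H →L[𝕜] H} (hA : ‖A‖ ≤ 1) (J : ℕ) (φ : H) :
    ‖φ - (A ^ J) φ‖ ≤ J * ‖φ - A φ‖ := by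
  induction J with
  | zero => simp
  | succ J ih =>
    rw [pow_succ', Nat.cast_succ, add_mul, one_mul, add_comm]
    exact (norm_sub_mul_apply_le hA _ φ).trans (by gcongr)

theorem norm_sub_apply_le_of_approx {A : H →L[𝕜] H} (hA : ‖A‖ ≤ 1) {c : 𝕜} (hc : ‖c‖ ≤ 1)
    (φ ψ : H) : ‖ψ - A ψ‖ ≤ ‖φ - A φ‖ + 2 * ‖ψ - c • φ‖ := by
  have hAnorm (χ : H) : ‖A χ‖ ≤ ‖χ‖ := by simpa using A.le_of_opNorm_le hA χ
  calc ‖ψ - A ψ‖ = ‖c • (φ - A φ) + ((ψ - c • φ) - A (ψ - c • φ))‖ := by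
        simp only [map_sub, map_smul, smul_sub]; congr 1; abel
    _ ≤ ‖c‖ * ‖φ - A φ‖ + (‖ψ - c • φ‖ + ‖A (ψ - c • φ)‖) := by
        rw [← norm_smul]
        exact (norm_add_le _ _).trans (by gcongr; exact norm_sub_le _ _)
    _ ≤ 1 * ‖φ - A φ‖ + (‖ψ - c • φ‖ + ‖ψ - c • φ‖) := by gcongr; exact hAnorm _
    _ = ‖φ - A φ‖ + 2 * ‖ψ - c • φ‖ := by ring

variable {ι 𝒜 : Type*} [CommRing 𝒜] (π : 𝒜 →+* (H →L[𝕜] H)) {a : ι → 𝒜} {s : Finset ι}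

theorem norm_map_prod_le_one (ha : ∀ i ∈ s, ‖π (a i)‖ ≤ 1) : ‖π (∏ i ∈ s, a i)‖ ≤ 1 :=
  Finset.prod_induction a (‖π ·‖ ≤ 1)
    (fun x y hx hy => by
      rw [map_mul]; exact (norm_mul_le _ _).trans (mul_le_one₀ hx (norm_nonneg _) hy))
    (by rw [map_one]; exact ContinuousLinearMap.norm_id_le) ha

theorem norm_sub_map_prod_apply_le (ha : ∀ i ∈ s, ‖π (a i)‖ ≤ 1) (φ : H) :
    ‖φ - π (∏ i ∈ s, a i) φ‖ ≤ ∑ i ∈ s, ‖φ - π (a i) φ‖ := by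
  induction s using Finset.cons_induction with
  | empty => simp
  | cons i s hi ih =>
    rw [Finset.prod_cons, Finset.sum_cons, map_mul]
    refine (norm_sub_mul_apply_le (ha i (Finset.mem_cons_self i s)) _ φ).trans ?_
    gcongr
    exact ih fun j hj => ha j (Finset.mem_cons_of_mem hj)

theorem norm_map_prod_le_of_sum_sq_le (hs : s.Nonempty) (ha : ∀ i ∈ s, ‖π (a i)‖ ≤ 1)
    {θ : ℝ} (hθ : 0 ≤ θ) (hsum : ∀ φ, ∑ i ∈ s, ‖π (a i) φ‖ ^ 2 ≤ s.card * (θ * ‖φ‖) ^ 2) :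
    ‖π (∏ i ∈ s, a i)‖ ≤ θ := by
  classical
  refine ContinuousLinearMap.opNorm_le_bound _ hθ fun φ => ?_
  have hfactor : ∀ i ∈ s, ‖π (∏ i ∈ s, a i) φ‖ ^ 2 ≤ ‖π (a i) φ‖ ^ 2 := by
    intro i hi
    rw [← Finset.prod_erase_mul s a hi, map_mul, mul_apply_eq_comp]
    have hrest := norm_map_prod_le_one π fun j (hj : j ∈ s.erase i) =>
      ha j (Finset.mem_of_mem_erase hj)
    gcongr
    simpa using ContinuousLinearMap.le_of_opNorm_le _ hrest (π (a i) φ)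
  have hcard : (0 : ℝ) < s.card := by exact_mod_cast hs.card_pos
  have hmean : s.card * ‖π (∏ i ∈ s, a i) φ‖ ^ 2 ≤ s.card * (θ * ‖φ‖) ^ 2 := by
    simpa using (Finset.sum_le_sum hfactor).trans (hsum φ)
  exact le_of_sq_le_sq (le_of_mul_le_mul_left hmean hcard) (by positivity)

theorem norm_le_of_commuting_contractions (hs : s.Nonempty) (ha : ∀ i ∈ s, ‖π (a i)‖ ≤ 1)
    {θ : ℝ} (hθ : 0 ≤ θ) (hsum : ∀ φ, ∑ i ∈ s, ‖π (a i) φ‖ ^ 2 ≤ s.card * (θ * ‖φ‖) ^ 2)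
    (J : ℕ) (φ : H) :
    ‖φ‖ ≤ θ ^ J * ‖φ‖ + ∑ i ∈ s, ‖φ - (π (a i) ^ J) φ‖ := by
  have hprod : ‖(π (∏ i ∈ s, a i) ^ J) φ‖ ≤ θ ^ J * ‖φ‖ :=
    (norm_pow_apply_le _ J φ).trans
      (by gcongr; exact norm_map_prod_le_of_sum_sq_le π hs ha hθ hsum)
  have hfixed : ‖φ - (π (∏ i ∈ s, a i) ^ J) φ‖ ≤ ∑ i ∈ s, ‖φ - (π (a i) ^ J) φ‖ := by
    have := norm_sub_map_prod_apply_le π (a := fun i => a i ^ J)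
      (fun i hi => by rw [map_pow]; exact norm_pow_le_one (ha i hi) J) φ
    simpa only [Finset.prod_pow, map_pow] using this
  exact (norm_le_norm_add_norm_sub' _ _).trans (add_le_add hprod hfixed)

end Commuting

section Positive

variable {H : Type*} [NormedAddCommGroup H] [InnerProductSpace ℂ H] [CompleteSpace H]
  {X : H →L[ℂ] H}

theorem operatorSqrt_isPositive (A : H →L[ℂ] H) : (operatorSqrt A).IsPositive :=
  (ContinuousLinearMap.nonneg_iff_isPositive _).1 (CFC.sqrt_nonneg A)

theorem adjoint_operatorSqrt (A : H →L[ℂ] H) :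
    ContinuousLinearMap.adjoint (operatorSqrt A) = operatorSqrt A :=
  (operatorSqrt_isPositive A).isSelfAdjoint.adjoint_eq

theorem operatorSqrt_mul_self (hX : X.IsPositive) : operatorSqrt X * operatorSqrt X = X :=
  CFC.sqrt_mul_sqrt_self X ((ContinuousLinearMap.nonneg_iff_isPositive X).2 hX)

theorem inner_apply_eq_inner_operatorSqrt (hX : X.IsPositive) (φ ψ : H) :
    ⟪φ, X ψ⟫_ℂ = ⟪operatorSqrt X φ, operatorSqrt X ψ⟫_ℂ := by
  rw [← ContinuousLinearMap.adjoint_inner_right, adjoint_operatorSqrt, ← mul_apply_eq_comp,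
    operatorSqrt_mul_self hX]

theorem norm_apply_sq_le_re_inner (hX : X.IsPositive) (hX1 : ‖X‖ ≤ 1) (φ : H) :
    ‖X φ‖ ^ 2 ≤ (⟪φ, X φ⟫_ℂ).re := by
  have hX0 : 0 ≤ X := (ContinuousLinearMap.nonneg_iff_isPositive X).2 hX
  have hsq : X ^ 2 ≤ X ^ 1 :=
    CStarAlgebra.pow_antitone hX0 ((CStarAlgebra.norm_le_one_iff_of_nonneg X hX0).1 hX1) one_le_two
  have hle := ((ContinuousLinearMap.le_def _ _).1 hsq).re_inner_nonneg_right φ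
  have hsquare : ⟪φ, (X ^ 2) φ⟫_ℂ = (‖X φ‖ : ℂ) ^ 2 := by
    rw [pow_two, mul_apply_eq_comp, ← ContinuousLinearMap.adjoint_inner_left,
      hX.isSelfAdjoint.adjoint_eq, inner_self_eq_norm_sq_to_K]
    rfl
  rw [pow_one, sub_apply, inner_sub_right, hsquare, map_sub] at hle
  have : (RCLike.re ((‖X φ‖ : ℂ) ^ 2)) = ‖X φ‖ ^ 2 := by norm_cast
  simpa [this] using hle

theorem norm_sub_apply_sq_le (hX : X.IsPositive) (hX1 : ‖X‖ ≤ 1) (φ : H) :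
    ‖φ - X φ‖ ^ 2 ≤ ‖φ‖ ^ 2 - ‖X φ‖ ^ 2 := by
  have hexpand := @norm_sub_sq ℂ H _ _ _ φ (X φ)
  have := norm_apply_sq_le_re_inner hX hX1 φ
  rw [RCLike.re_eq_complex_re] at hexpand
  linarith

theorem norm_one_sub_le_one (hX : X.IsPositive) (hX1 : ‖X‖ ≤ 1) : ‖1 - X‖ ≤ 1 :=
  ContinuousLinearMap.opNorm_le_bound _ zero_le_one fun φ => by
    rw [one_mul]
    refine le_of_sq_le_sq ((norm_sub_apply_sq_le hX hX1 φ).trans ?_) (norm_nonneg φ)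
    linarith [sq_nonneg ‖X φ‖]

end Positive

section Weight

theorem inner_displacement_displacement (a : ℝ) (φ ψ : WeightSpace) :
    ⟪displacement a φ, displacement a ψ⟫_ℂ = ⟪φ, ψ⟫_ℂ :=
  LinearIsometry.inner_map_map (Lp.compMeasurePreservingₗᵢ ℂ (fun E : ℝ => E - a)
    (measurePreserving_sub_right volume a)) φ ψ

theorem norm_displacement_apply (a : ℝ) (φ : WeightSpace) : ‖displacement a φ‖ = ‖φ‖ :=
  LinearIsometry.norm_map (Lp.compMeasurePreservingₗᵢ ℂ (fun E : ℝ => E - a)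
    (measurePreserving_sub_right volume a)) φ

theorem norm_displacement_le (a : ℝ) : ‖displacement a‖ ≤ 1 :=
  LinearIsometry.norm_toContinuousLinearMap_le _

theorem displacement_zero : displacement 0 = 1 := by
  ext1 φ
  apply Lp.ext
  filter_upwards [displacement_apply 0 φ] with E h
  simpa using h

theorem displacement_add (a b : ℝ) : displacement (a + b) = displacement a * displacement b := by
  ext1 φ
  apply Lp.ext
  have hb := (measurePreserving_sub_right volume a).quasiMeasurePreserving.ae
    (displacement_apply b φ)
  filter_upwards [displacement_apply (a + b) φ, displacement_apply a (displacement b φ), hb]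
    with E h1 h2 h3
  rw [h1, mul_apply_eq_comp, h2, h3, sub_sub]

theorem weightPhase_zero : weightPhase 0 = 1 := by
  ext1 φ
  apply Lp.ext
  filter_upwards [weightPhase_apply 0 φ] with E h
  simpa using h

theorem weightPhase_add (s t : ℝ) : weightPhase (s + t) = weightPhase s * weightPhase t := by
  ext1 φ
  apply Lp.ext
  filter_upwards [weightPhase_apply (s + t) φ, weightPhase_apply s (weightPhase t φ),
    weightPhase_apply t φ] with E h1 h2 h3
  rw [h1, mul_apply_eq_comp, h2, h3, ← mul_assoc, ← Complex.exp_add]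
  congr 2
  push_cast
  ring

theorem weightPhase_neg_mul_self (s : ℝ) : weightPhase (-s) * weightPhase s = 1 := by
  rw [← weightPhase_add, neg_add_cancel, weightPhase_zero]

theorem weightPhase_mul_displacement (s a : ℝ) :
    weightPhase s * displacement a
      = Complex.exp (Complex.I * s * a) • (displacement a * weightPhase s) := by
  ext1 φ
  apply Lp.ext
  have hb := (measurePreserving_sub_right volume a).quasiMeasurePreserving.ae
    (weightPhase_apply s φ)
  filter_upwards [weightPhase_apply s (displacement a φ), displacement_apply a φ,
    displacement_apply a (weightPhase s φ), hb,
    Lp.coeFn_smul (Complex.exp (Complex.I * s * a)) (displacement a (weightPhase s φ))]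
    with E h1 h2 h3 h4 h5
  rw [mul_apply_eq_comp, h1, h2]
  refine Eq.trans ?_ h5.symm
  rw [Pi.smul_apply, h3, h4, smul_eq_mul, ← mul_assoc, ← Complex.exp_add]
  congr 2
  push_cast
  ring

/-- The energy distribution `|φ(E)|² dE` of a single, not necessarily normalised, weight vector. -/
def energyMeasure (φ : WeightSpace) : Measure ℝ :=
  volume.withDensity fun E => ‖φ E‖ₑ ^ 2

theorem measurable_enorm_sq_coeFn (φ : WeightSpace) : Measurable fun E => ‖φ E‖ₑ ^ 2 :=
  (Lp.stronglyMeasurable φ).measurable.enorm.pow_const 2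

theorem enorm_sq_eq_lintegral {α F : Type*} [MeasurableSpace α] [NormedAddCommGroup F]
    {μ : Measure α} (f : Lp F 2 μ) : ‖f‖ₑ ^ 2 = ∫⁻ x, ‖f x‖ₑ ^ 2 ∂μ := by
  rw [Lp.enorm_def, eLpNorm_eq_lintegral_rpow_enorm_toReal two_ne_zero ENNReal.ofNat_ne_top,
    ← ENNReal.rpow_natCast, ← ENNReal.rpow_mul]
  norm_num

theorem enorm_sq_eq_lintegral_of_ae_eq_mul {φ ψ : WeightSpace} {f : ℝ → ℂ} (hf : Measurable f)
    (hψ : ψ =ᵐ[volume] fun E => f E * φ E) : ‖ψ‖ₑ ^ 2 = ∫⁻ E, ‖f E‖ₑ ^ 2 ∂energyMeasure φ := by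
  rw [energyMeasure, lintegral_withDensity_eq_lintegral_mul _ (measurable_enorm_sq_coeFn φ)
    (hf.enorm.pow_const 2), enorm_sq_eq_lintegral]
  refine lintegral_congr_ae (hψ.mono fun E hE => ?_)
  simp only [hE, enorm_mul, mul_pow, Pi.mul_apply, mul_comm]

theorem energyMeasure_univ (φ : WeightSpace) : energyMeasure φ Set.univ = ‖φ‖ₑ ^ 2 := by
  rw [enorm_sq_eq_lintegral_of_ae_eq_mul (φ := φ) (f := 1) measurable_one (by simp)]
  simp

instance (φ : WeightSpace) : IsFiniteMeasure (energyMeasure φ) :=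
  ⟨by rw [energyMeasure_univ]; exact ENNReal.pow_lt_top enorm_lt_top⟩

theorem norm_weightPhase_apply (s : ℝ) (φ : WeightSpace) : ‖weightPhase s φ‖ = ‖φ‖ := by
  have h := enorm_sq_eq_lintegral_of_ae_eq_mul (by fun_prop) (weightPhase_apply s φ)
  have hphase (E : ℝ) : ‖Complex.exp (Complex.I * s * E)‖ₑ = 1 := by
    rw [← ofReal_norm, Complex.norm_exp]; simp
  simp only [hphase, one_pow, lintegral_one, energyMeasure_univ] at h
  simpa [sq_eq_sq₀] using congrArg ENNReal.toReal h

theorem norm_exp_sub_exp_le (s x y : ℝ) :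
    ‖Complex.exp (Complex.I * s * x) - Complex.exp (Complex.I * s * y)‖ ≤ |s| * |x - y| := by
  have hfactor : Complex.exp (Complex.I * s * x) - Complex.exp (Complex.I * s * y)
      = Complex.exp (Complex.I * s * y)
        * (Complex.exp (Complex.I * ((s * (x - y) : ℝ) : ℂ)) - 1) := by
    rw [mul_sub, ← Complex.exp_add, mul_one]
    congr 2
    push_cast
    ring
  have hphase : ‖Complex.exp (Complex.I * s * y)‖ = 1 := by simp [Complex.norm_exp]
  rw [hfactor, norm_mul, hphase, one_mul, ← abs_mul]
  exact Real.norm_exp_I_mul_ofReal_sub_one_le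

theorem enorm_exp_sub_exp_sq_le (s m L E : ℝ) :
    ‖Complex.exp (Complex.I * s * E) - Complex.exp (Complex.I * s * m)‖ₑ ^ 2
      ≤ ENNReal.ofReal ((|s| * L) ^ 2) + (Metric.ball m L)ᶜ.indicator (fun _ => 4) E := by
  rw [← ofReal_norm, ← ENNReal.ofReal_pow (norm_nonneg _)]
  by_cases hE : E ∈ Metric.ball m L
  · refine le_add_right (ENNReal.ofReal_le_ofReal ?_)
    gcongr
    exact (norm_exp_sub_exp_le s E m).trans
      (by gcongr; exact (Real.dist_eq E m ▸ Metric.mem_ball.1 hE).le)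
  · rw [Set.indicator_of_mem (by exact hE)]
    refine le_add_left (ENNReal.ofReal_le_ofNat.2 ?_)
    have hle : ‖Complex.exp (Complex.I * s * E) - Complex.exp (Complex.I * s * m)‖ ≤ 2 := by
      refine (norm_sub_le _ _).trans ?_
      simp only [Complex.norm_exp]
      norm_num
    nlinarith [norm_nonneg (Complex.exp (Complex.I * s * E) - Complex.exp (Complex.I * s * m))]

theorem norm_weightPhase_sub_smul_sq_le (s m L : ℝ) (φ : WeightSpace) :
    ‖weightPhase s φ - Complex.exp (Complex.I * s * m) • φ‖ ^ 2
      ≤ (|s| * L) ^ 2 * ‖φ‖ ^ 2 + 4 * (energyMeasure φ).real (Metric.ball m L)ᶜ := by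
  have hmul : weightPhase s φ - Complex.exp (Complex.I * s * m) • φ =ᵐ[volume] fun E =>
      (Complex.exp (Complex.I * s * E) - Complex.exp (Complex.I * s * m)) * φ E := by
    filter_upwards [Lp.coeFn_sub (weightPhase s φ) (Complex.exp (Complex.I * s * m) • φ),
      weightPhase_apply s φ, Lp.coeFn_smul (Complex.exp (Complex.I * s * m)) φ] with E h1 h2 h3
    rw [h1, Pi.sub_apply, h2, h3, Pi.smul_apply, smul_eq_mul, sub_mul]
  have hle : ‖weightPhase s φ - Complex.exp (Complex.I * s * m) • φ‖ₑ ^ 2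
      ≤ ENNReal.ofReal ((|s| * L) ^ 2) * ‖φ‖ₑ ^ 2
        + 4 * energyMeasure φ (Metric.ball m L)ᶜ := by
    rw [enorm_sq_eq_lintegral_of_ae_eq_mul (by fun_prop) hmul]
    refine (lintegral_mono fun E => enorm_exp_sub_exp_sq_le s m L E).trans_eq ?_
    rw [lintegral_add_left measurable_const, lintegral_const, energyMeasure_univ,
      lintegral_indicator_const Metric.isOpen_ball.measurableSet.compl]
  have htop : ENNReal.ofReal ((|s| * L) ^ 2) * ‖φ‖ₑ ^ 2 + 4 * energyMeasure φ (Metric.ball m L)ᶜ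
      ≠ ⊤ := by finiteness
  have h := ENNReal.toReal_mono htop hle
  rw [ENNReal.toReal_add (by finiteness) (by finiteness)] at h
  simpa [ENNReal.toReal_ofReal (sq_nonneg (|s| * L)), measureReal_def] using h

theorem norm_weightPhase_sub_smul_le (s m : ℝ) {L : ℝ} (hL : 0 ≤ L) (φ : WeightSpace) :
    ‖weightPhase s φ - Complex.exp (Complex.I * s * m) • φ‖
      ≤ |s| * L * ‖φ‖ + 2 * √((energyMeasure φ).real (Metric.ball m L)ᶜ) := by
  refine le_of_sq_le_sq ((norm_weightPhase_sub_smul_sq_le s m L φ).trans ?_) (by positivity)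
  set P := (energyMeasure φ).real (Metric.ball m L)ᶜ
  have hP : √P ^ 2 = P := Real.sq_sqrt measureReal_nonneg
  have hcross : 0 ≤ |s| * L * ‖φ‖ * √P := by positivity
  linear_combination 4 * hcross - 4 * hP

end Weight

section Combinations

/-- The algebra homomorphism that sends a formal combination `∑ a, c a • [a]` to the operator
`∑ a, c a • Γ_a`. -/
def displacementHom : AddMonoidAlgebra ℂ ℝ →ₐ[ℂ] (WeightSpace →L[ℂ] WeightSpace) :=
  AddMonoidAlgebra.lift ℂ (WeightSpace →L[ℂ] WeightSpace) ℝ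
    { toFun := fun a => displacement a.toAdd
      map_one' := by simp [displacement_zero]
      map_mul' := fun a b => by simp [displacement_add] }

@[simp]
theorem displacementHom_single (a : ℝ) (c : ℂ) :
    displacementHom (AddMonoidAlgebra.single a c) = c • displacement a := by
  simp [displacementHom]

/-- The automorphism `[a] ↦ exp(-i s a) [a]`, implemented by the phase `exp(i s H_W)`. -/
def modulate (s : ℝ) : AddMonoidAlgebra ℂ ℝ →ₐ[ℂ] AddMonoidAlgebra ℂ ℝ :=
  AddMonoidAlgebra.lift ℂ (AddMonoidAlgebra ℂ ℝ) ℝ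
    { toFun := fun a => AddMonoidAlgebra.single a.toAdd (Complex.exp (-(Complex.I * s * a.toAdd)))
      map_one' := by simp [AddMonoidAlgebra.one_def]
      map_mul' := fun a b => by
        rw [AddMonoidAlgebra.single_mul_single, ← Complex.exp_add]
        congr 2
        push_cast [toAdd_mul]
        ring }

@[simp]
theorem modulate_single (s a : ℝ) (c : ℂ) :
    modulate s (AddMonoidAlgebra.single a c)
      = AddMonoidAlgebra.single a (c * Complex.exp (-(Complex.I * s * a))) := by
  simp [modulate]

theorem displacementHom_modulate (s : ℝ) (x : AddMonoidAlgebra ℂ ℝ) :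
    displacementHom (modulate s x) = weightPhase (-s) * displacementHom x * weightPhase s := by
  induction x using AddMonoidAlgebra.induction_linear with
  | zero => simp
  | add x y hx hy => simp [hx, hy, mul_add, add_mul]
  | single a c =>
    rw [modulate_single, displacementHom_single, displacementHom_single, mul_smul_comm,
      weightPhase_mul_displacement, smul_mul_assoc, smul_mul_assoc, mul_assoc (displacement a),
      weightPhase_neg_mul_self, mul_one, smul_smul]
    congr 3
    push_cast
    ring

theorem norm_displacementHom_modulate_apply (s : ℝ) (x : AddMonoidAlgebra ℂ ℝ) (φ : WeightSpace) :
    ‖displacementHom (modulate s x) φ‖ = ‖displacementHom x (weightPhase s φ)‖ := by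
  rw [displacementHom_modulate, mul_apply_eq_comp, mul_apply_eq_comp, norm_weightPhase_apply]

theorem norm_displacementHom_modulate_le (s : ℝ) (x : AddMonoidAlgebra ℂ ℝ) :
    ‖displacementHom (modulate s x)‖ ≤ ‖displacementHom x‖ :=
  ContinuousLinearMap.opNorm_le_bound _ (norm_nonneg _) fun φ => by
    rw [norm_displacementHom_modulate_apply, ← norm_weightPhase_apply s φ]
    exact ContinuousLinearMap.le_opNorm _ _

theorem eq_sum_single_of_support_subset {Ω : Finset ℝ} {x : AddMonoidAlgebra ℂ ℝ}
    (hx : x.coeff.support ⊆ Ω) : x = ∑ a ∈ Ω, AddMonoidAlgebra.single a (x.coeff a) := by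
  conv_lhs => rw [← AddMonoidAlgebra.sum_coeff_single x]
  exact Finsupp.sum_of_support_subset _ hx _ (by simp)

variable {Ω : Finset ℝ} {τ : ℝ}

theorem sum_smul_modulate_single {p : Polynomial ℂ} {d : ℕ} (hp : p.natDegree < d) (a : ℝ) (c : ℂ) :
    ∑ i ∈ Finset.range d, p.coeff i • modulate (i * τ) (AddMonoidAlgebra.single a c)
      = AddMonoidAlgebra.single a (c * p.eval (Complex.exp (-(Complex.I * τ * a)))) := by
  simp only [modulate_single, AddMonoidAlgebra.smul_single, smul_eq_mul]
  simp only [← AddMonoidAlgebra.singleAddHom_apply, ← map_sum]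
  rw [Polynomial.eval_eq_sum_range' hp, Finset.mul_sum]
  congr 1
  refine Finset.sum_congr rfl fun i _ => ?_
  have hpow : -(Complex.I * ((i * τ : ℝ) : ℂ) * a) = (i : ℂ) * -(Complex.I * τ * a) := by
    push_cast
    ring
  rw [← Complex.exp_nat_mul, hpow]
  ring

/-- The coefficients `q` are those of the Lagrange polynomial that is `1` at the node
`exp(-i τ 0) = 1` and `0` at the other nodes `exp(-i τ a)`, `a ∈ Ω`. -/
theorem exists_sum_smul_modulate_eq_single (h0 : 0 ∈ Ω)
    (hτ : Set.InjOn (fun a : ℝ => Complex.exp (-(Complex.I * τ * a))) Ω) :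
    ∃ q : ℕ → ℂ, ∀ x : AddMonoidAlgebra ℂ ℝ, x.coeff.support ⊆ Ω →
      ∑ i ∈ Finset.range Ω.card, q i • modulate (i * τ) x
        = AddMonoidAlgebra.single 0 (x.coeff 0) := by
  set p := Lagrange.basis Ω (fun a : ℝ => Complex.exp (-(Complex.I * τ * a))) 0
  have hdeg : p.natDegree < Ω.card := by
    rw [Polynomial.natDegree_lt_iff_degree_lt (Lagrange.basis_ne_zero hτ h0),
      Lagrange.degree_basis hτ h0]
    exact_mod_cast Nat.sub_lt (Finset.card_pos.2 ⟨0, h0⟩) one_pos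
  refine ⟨p.coeff, fun x hx => ?_⟩
  conv_lhs => rw [eq_sum_single_of_support_subset hx]
  simp only [map_sum, Finset.smul_sum]
  rw [Finset.sum_comm, Finset.sum_eq_single_of_mem 0 h0]
  · rw [sum_smul_modulate_single hdeg, Lagrange.eval_basis_self hτ h0, mul_one]
  · intro a ha ha0
    rw [sum_smul_modulate_single hdeg, Lagrange.eval_basis_of_ne
      (v := fun a : ℝ => Complex.exp (-(Complex.I * τ * a))) ha0.symm ha, mul_zero,
      AddMonoidAlgebra.single_zero]

theorem exists_norm_coeff_sq_mul_le (h0 : 0 ∈ Ω)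
    (hτ : Set.InjOn (fun a : ℝ => Complex.exp (-(Complex.I * τ * a))) Ω) :
    ∃ N : ℝ, 0 < N ∧ ∀ x : AddMonoidAlgebra ℂ ℝ, x.coeff.support ⊆ Ω → ∀ φ : WeightSpace,
      ‖x.coeff 0‖ ^ 2 * ‖φ‖ ^ 2
        ≤ N * ∑ i ∈ Finset.range Ω.card, ‖displacementHom x (weightPhase (i * τ) φ)‖ ^ 2 := by
  obtain ⟨q, hq⟩ := exists_sum_smul_modulate_eq_single h0 hτ
  refine ⟨1 + ∑ i ∈ Finset.range Ω.card, ‖q i‖ ^ 2, by positivity, fun x hx φ => ?_⟩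
  have hinterp : x.coeff 0 • φ
      = ∑ i ∈ Finset.range Ω.card, q i • displacementHom (modulate (i * τ) x) φ := by
    simpa [displacement_zero] using congrArg (displacementHom · φ) (hq x hx).symm
  have htriangle : ‖x.coeff 0‖ * ‖φ‖ ≤ ∑ i ∈ Finset.range Ω.card,
      ‖q i‖ * ‖displacementHom x (weightPhase (i * τ) φ)‖ := by
    rw [← norm_smul, hinterp]
    refine (norm_sum_le _ _).trans_eq ?_
    simp only [norm_smul, norm_displacementHom_modulate_apply]
  calc ‖x.coeff 0‖ ^ 2 * ‖φ‖ ^ 2 = (‖x.coeff 0‖ * ‖φ‖) ^ 2 := (mul_pow _ _ _).symm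
    _ ≤ (∑ i ∈ Finset.range Ω.card,
          ‖q i‖ * ‖displacementHom x (weightPhase (i * τ) φ)‖) ^ 2 := by gcongr
    _ ≤ _ := Finset.sum_mul_sq_le_sq_mul_sq _ _ _
    _ ≤ _ := by gcongr; exact le_add_of_nonneg_left zero_le_one

theorem injOn_exp_neg_I_mul (hτ0 : 0 < τ) (hτ : ∀ a ∈ Ω, τ * |a| ≤ 1) :
    Set.InjOn (fun a : ℝ => Complex.exp (-(Complex.I * τ * a))) Ω := by
  intro a ha b hb hab
  have him (c : ℝ) : (-(Complex.I * τ * c)).im = -(τ * c) := by simp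
  have hbound (c : ℝ) (hc : c ∈ Ω) : -1 ≤ τ * c ∧ τ * c ≤ 1 :=
    abs_le.1 (by rw [abs_mul, abs_of_pos hτ0]; exact hτ c hc)
  have hpi := Real.pi_gt_three
  have hlt (c : ℝ) (hc : c ∈ Ω) : -Real.pi < (-(Complex.I * τ * c)).im := by
    rw [him]; linarith [hbound c hc]
  have hle (c : ℝ) (hc : c ∈ Ω) : (-(Complex.I * τ * c)).im ≤ Real.pi := by
    rw [him]; linarith [hbound c hc]
  have h := congrArg Complex.im
    (Complex.exp_inj_of_neg_pi_lt_of_le_pi (hlt a ha) (hle a ha) (hlt b hb) (hle b hb) hab)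
  rw [him, him, neg_inj] at h
  exact mul_left_cancel₀ hτ0.ne' h

theorem exists_pos_injOn_exp_neg_I_mul (Ω : Finset ℝ) {K : ℝ} (hK : 0 ≤ K) :
    ∃ τ : ℝ, 0 < τ ∧ τ * K ≤ 1 ∧
      Set.InjOn (fun a : ℝ => Complex.exp (-(Complex.I * τ * a))) Ω := by
  have hsum : 0 ≤ ∑ a ∈ Ω, |a| := Finset.sum_nonneg fun _ _ => abs_nonneg _
  have hpos : 0 < 1 + ∑ a ∈ Ω, |a| + K := by positivity
  refine ⟨(1 + ∑ a ∈ Ω, |a| + K)⁻¹, inv_pos.2 hpos, ?_,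
    injOn_exp_neg_I_mul (inv_pos.2 hpos) fun a ha => ?_⟩
  · rw [inv_mul_le_one₀ hpos]
    linarith
  · rw [inv_mul_le_one₀ hpos]
    linarith [Finset.single_le_sum (f := fun a : ℝ => |a|) (fun _ _ => abs_nonneg _) ha]

end Combinations

section LowerBound

variable {Ω : Finset ℝ} {τ : ℝ} {x : AddMonoidAlgebra ℂ ℝ}

theorem norm_displacementHom_modulate_one_sub_le (hx : (displacementHom x).IsPositive)
    (hx1 : ‖displacementHom x‖ ≤ 1) (s : ℝ) : ‖displacementHom (modulate s (1 - x))‖ ≤ 1 := by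
  refine (norm_displacementHom_modulate_le s _).trans ?_
  rw [map_sub, map_one]
  exact norm_one_sub_le_one hx hx1

theorem norm_displacementHom_modulate_one_sub_sq_le (hx : (displacementHom x).IsPositive)
    (hx1 : ‖displacementHom x‖ ≤ 1) (s : ℝ) (φ : WeightSpace) :
    ‖displacementHom (modulate s (1 - x)) φ‖ ^ 2
      ≤ ‖φ‖ ^ 2 - ‖displacementHom x (weightPhase s φ)‖ ^ 2 := by
  rw [norm_displacementHom_modulate_apply, map_sub, map_one, ← norm_weightPhase_apply s φ]
  exact norm_sub_apply_sq_le hx hx1 _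

theorem norm_sub_modulate_pow_apply_le (hx : (displacementHom x).IsPositive)
    (hx1 : ‖displacementHom x‖ ≤ 1) (s : ℝ) {c : ℂ} (hc : ‖c‖ ≤ 1) (J : ℕ) (φ : WeightSpace) :
    ‖φ - (displacementHom (modulate s (1 - x)) ^ J) φ‖
      ≤ J * ‖displacementHom x φ‖ + 2 * ‖weightPhase s φ - c • φ‖ := by
  have hcontr : ‖displacementHom (1 - x)‖ ≤ 1 := by
    rw [map_sub, map_one]
    exact norm_one_sub_le_one hx hx1
  have hshift : ‖φ - (displacementHom (modulate s (1 - x)) ^ J) φ‖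
      = ‖weightPhase s φ - (displacementHom (1 - x) ^ J) (weightPhase s φ)‖ := by
    have := norm_displacementHom_modulate_apply s (1 - (1 - x) ^ J) φ
    simpa only [map_sub, map_one, map_pow, sub_apply, one_apply_eq_self] using this
  have hfixed : ‖φ - (displacementHom (1 - x) ^ J) φ‖ ≤ J * ‖displacementHom x φ‖ := by
    refine (norm_sub_pow_apply_le hcontr J φ).trans_eq ?_
    rw [map_sub, map_one, sub_apply, one_apply_eq_self, sub_sub_cancel]
  rw [hshift]
  exact (norm_sub_apply_le_of_approx (norm_pow_le_one hcontr J) hc φ _).trans (by gcongr)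

theorem exists_sum_norm_sq_le (h0 : 0 ∈ Ω)
    (hτ : Set.InjOn (fun a : ℝ => Complex.exp (-(Complex.I * τ * a))) Ω) {c₀ : ℝ} (hc₀ : 0 < c₀) :
    ∃ θ : ℝ, 0 ≤ θ ∧ θ < 1 ∧ ∀ x : AddMonoidAlgebra ℂ ℝ, x.coeff.support ⊆ Ω →
      c₀ ≤ ‖x.coeff 0‖ → (displacementHom x).IsPositive → ‖displacementHom x‖ ≤ 1 →
      ∀ φ : WeightSpace,
        ∑ i ∈ Finset.range Ω.card, ‖displacementHom (modulate (i * τ) (1 - x)) φ‖ ^ 2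
          ≤ Ω.card * (θ * ‖φ‖) ^ 2 := by
  obtain ⟨N, hN0, hN⟩ := exists_norm_coeff_sq_mul_le h0 hτ
  have hd : (0 : ℝ) < Ω.card := Nat.cast_pos.2 (Finset.card_pos.2 ⟨0, h0⟩)
  set κ : ℝ := c₀ ^ 2 / (Ω.card * N) with hκ
  have hκ0 : 0 < κ := by positivity
  refine ⟨√(1 - κ), Real.sqrt_nonneg _, (Real.sqrt_lt' one_pos).2 (by linarith), ?_⟩
  intro x hx hxc hpos hx1 φ
  set S := ∑ i ∈ Finset.range Ω.card, ‖displacementHom x (weightPhase (i * τ) φ)‖ ^ 2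
  have hS : Ω.card * κ * ‖φ‖ ^ 2 ≤ S := by
    have hNS : c₀ ^ 2 * ‖φ‖ ^ 2 ≤ N * S := le_trans (by gcongr) (hN x hx φ)
    have hcancel : Ω.card * κ * ‖φ‖ ^ 2 = c₀ ^ 2 * ‖φ‖ ^ 2 / N := by
      rw [hκ]
      field_simp
    rw [hcancel, div_le_iff₀' hN0]
    exact hNS
  calc ∑ i ∈ Finset.range Ω.card, ‖displacementHom (modulate (i * τ) (1 - x)) φ‖ ^ 2
      ≤ ∑ i ∈ Finset.range Ω.card,
          (‖φ‖ ^ 2 - ‖displacementHom x (weightPhase (i * τ) φ)‖ ^ 2) :=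
        Finset.sum_le_sum fun i _ =>
          norm_displacementHom_modulate_one_sub_sq_le hpos hx1 (i * τ) φ
    _ = Ω.card * ‖φ‖ ^ 2 - S := by
        rw [Finset.sum_sub_distrib, Finset.sum_const, Finset.card_range, nsmul_eq_mul]
    _ ≤ Ω.card * ((1 - κ) * ‖φ‖ ^ 2) := by linarith
    _ ≤ Ω.card * (√(1 - κ) * ‖φ‖) ^ 2 := by
        rw [mul_pow, Real.sq_sqrt']
        gcongr
        exact le_max_left _ _

theorem exists_norm_le_norm_apply_add (h0 : 0 ∈ Ω)
    (hτ : Set.InjOn (fun a : ℝ => Complex.exp (-(Complex.I * τ * a))) Ω) {c₀ : ℝ} (hc₀ : 0 < c₀) :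
    ∃ J : ℕ, ∀ x : AddMonoidAlgebra ℂ ℝ, x.coeff.support ⊆ Ω → c₀ ≤ ‖x.coeff 0‖ →
      (displacementHom x).IsPositive → ‖displacementHom x‖ ≤ 1 →
      ∀ (c : ℕ → ℂ), (∀ i, ‖c i‖ ≤ 1) → ∀ φ : WeightSpace,
      ‖φ‖ ≤ 1 / 4 * ‖φ‖ + ∑ i ∈ Finset.range Ω.card,
        (J * ‖displacementHom x φ‖ + 2 * ‖weightPhase (i * τ) φ - c i • φ‖) := by
  obtain ⟨θ, hθ0, hθ1, hθ⟩ := exists_sum_norm_sq_le h0 hτ hc₀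
  obtain ⟨J, hJ⟩ := exists_pow_lt_of_lt_one (by norm_num : (0 : ℝ) < 1 / 4) hθ1
  refine ⟨J, fun x hx hxc hpos hx1 c hc φ => ?_⟩
  have hcontr := norm_le_of_commuting_contractions (s := Finset.range Ω.card)
    (a := fun i : ℕ => modulate (i * τ) (1 - x)) displacementHom.toRingHom
    (Finset.nonempty_range_iff.2 (Finset.card_ne_zero_of_mem h0))
    (fun i _ => norm_displacementHom_modulate_one_sub_le hpos hx1 (i * τ)) hθ0
    (by rw [Finset.card_range]; exact hθ x hx hxc hpos hx1) J φ
  refine hcontr.trans ?_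
  gcongr with i
  exact norm_sub_modulate_pow_apply_le hpos hx1 (i * τ) (hc i) J φ

/-- The coefficient of the tail does not depend on `L`, so that `L` can be chosen after the
admissible size of the tail. -/
theorem exists_norm_sq_le_re_inner_add (h0 : 0 ∈ Ω) {c₀ : ℝ} (hc₀ : 0 < c₀) {L : ℝ} (hL : 0 ≤ L) :
    ∃ C : ℝ, 0 < C ∧ ∀ x : AddMonoidAlgebra ℂ ℝ, x.coeff.support ⊆ Ω → c₀ ≤ ‖x.coeff 0‖ →
      (displacementHom x).IsPositive → ‖displacementHom x‖ ≤ 1 → ∀ (m : ℝ) (φ : WeightSpace),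
      ‖φ‖ ^ 2 ≤ C * (⟪φ, displacementHom x φ⟫_ℂ).re
        + 128 * Ω.card ^ 2 * (energyMeasure φ).real (Metric.ball m L)ᶜ := by
  obtain ⟨τ, hτ0, hτL, hτ⟩ := exists_pos_injOn_exp_neg_I_mul Ω
    (by positivity : 0 ≤ 8 * (Ω.card : ℝ) ^ 2 * L)
  obtain ⟨J, hJ⟩ := exists_norm_le_norm_apply_add h0 hτ hc₀
  set d : ℝ := (Ω.card : ℝ)
  refine ⟨8 * d ^ 2 * J ^ 2 + 1, by positivity, fun x hx hxc hpos hx1 m φ => ?_⟩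
  set P := (energyMeasure φ).real (Metric.ball m L)ᶜ
  have hP : √P ^ 2 = P := Real.sq_sqrt measureReal_nonneg
  have hphase : ∀ i ∈ Finset.range Ω.card,
      ‖weightPhase (i * τ) φ - Complex.exp (Complex.I * (i * τ : ℝ) * m) • φ‖
        ≤ d * τ * L * ‖φ‖ + 2 * √P := by
    intro i hi
    have hid : (i : ℝ) ≤ d := Nat.cast_le.2 (Finset.mem_range.1 hi).le
    refine (norm_weightPhase_sub_smul_le _ m hL φ).trans ?_
    rw [abs_of_nonneg (by positivity)]
    gcongr
  have hsum : ‖φ‖ ≤ 1 / 4 * ‖φ‖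
      + d * (J * ‖displacementHom x φ‖ + 2 * (d * τ * L * ‖φ‖ + 2 * √P)) := by
    refine (hJ x hx hxc hpos hx1 (fun i => Complex.exp (Complex.I * (i * τ : ℝ) * m))
      (fun i => by rw [Complex.norm_exp]; simp) φ).trans ?_
    gcongr
    refine (Finset.sum_le_card_nsmul _ _ _ fun i hi => ?_).trans_eq
      (by rw [Finset.card_range, nsmul_eq_mul])
    gcongr
    exact hphase i hi
  have hτφ := mul_le_mul_of_nonneg_right hτL (norm_nonneg φ)
  have hnorm : ‖φ‖ ≤ 2 * d * J * ‖displacementHom x φ‖ + 8 * d * √P := by linarith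
  have hinner := norm_apply_sq_le_re_inner hpos hx1 φ
  calc ‖φ‖ ^ 2 ≤ (2 * d * J * ‖displacementHom x φ‖ + 8 * d * √P) ^ 2 := by gcongr
    _ ≤ 2 * ((2 * d * J * ‖displacementHom x φ‖) ^ 2 + (8 * d * √P) ^ 2) := add_sq_le
    _ = 8 * d ^ 2 * J ^ 2 * ‖displacementHom x φ‖ ^ 2 + 128 * d ^ 2 * P := by
        linear_combination 128 * d ^ 2 * hP
    _ ≤ (8 * d ^ 2 * J ^ 2 + 1) * (⟪φ, displacementHom x φ⟫_ℂ).re + 128 * d ^ 2 * P := by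
        gcongr
        exact le_add_of_nonneg_right zero_le_one

end LowerBound

section HilbertSchmidt

variable {𝕜 H K ι κ : Type*} [RCLike 𝕜] [NormedAddCommGroup H] [InnerProductSpace 𝕜 H]
  [NormedAddCommGroup K] [InnerProductSpace 𝕜 K]

theorem hasSum_norm_inner_sq (b : HilbertBasis ι 𝕜 H) (x : H) :
    HasSum (fun k => ‖⟪b k, x⟫_𝕜‖ ^ 2) (‖x‖ ^ 2) := by
  have hterm (k : ι) : ⟪x, b k⟫_𝕜 * ⟪b k, x⟫_𝕜 = ((‖⟪b k, x⟫_𝕜‖ ^ 2 : ℝ) : 𝕜) := by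
    rw [← inner_conj_symm x, RCLike.conj_mul, RCLike.ofReal_pow]
  have h := b.hasSum_inner_mul_inner x x
  simp only [hterm, inner_self_eq_norm_sq_to_K, ← RCLike.ofReal_pow] at h
  exact (RCLike.hasSum_ofReal 𝕜).1 h

theorem enorm_sq_eq_ofReal {V : Type*} [SeminormedAddCommGroup V] (v : V) :
    ‖v‖ₑ ^ 2 = ENNReal.ofReal (‖v‖ ^ 2) := by
  rw [ENNReal.ofReal_pow (norm_nonneg _), ofReal_norm]

theorem tsum_enorm_inner_sq (b : HilbertBasis ι 𝕜 H) (x : H) :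
    ∑' k, ‖⟪b k, x⟫_𝕜‖ₑ ^ 2 = ‖x‖ₑ ^ 2 := by
  have h := hasSum_norm_inner_sq b x
  simp only [enorm_sq_eq_ofReal, ← h.tsum_eq]
  rw [ENNReal.ofReal_tsum_of_nonneg (fun _ => by positivity) h.summable]

/-- The squared Hilbert–Schmidt norm `∑ k, ‖A (b k)‖²`. It does not depend on the Hilbert basis `b`,
but keeping the basis explicit avoids choosing one for every space. -/
def hilbertSchmidtSq (b : HilbertBasis ι 𝕜 H) (A : H →L[𝕜] K) : ℝ≥0∞ :=
  ∑' k, ‖A (b k)‖ₑ ^ 2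

theorem summable_norm_inner_sq (b : HilbertBasis ι 𝕜 H) (c : HilbertBasis κ 𝕜 K)
    {A : H →L[𝕜] K} (hA : hilbertSchmidtSq b A ≠ ∞) :
    Summable fun p : ι × κ => ‖⟪c p.2, A (b p.1)⟫_𝕜‖ ^ 2 := by
  have htsum : ∑' p : ι × κ, ‖⟪c p.2, A (b p.1)⟫_𝕜‖ₑ ^ 2 = hilbertSchmidtSq b A := by
    rw [ENNReal.tsum_prod (f := fun k l => ‖⟪c l, A (b k)⟫_𝕜‖ₑ ^ 2)]
    simp only [tsum_enorm_inner_sq, hilbertSchmidtSq]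
  simpa only [enorm_sq_eq_ofReal, ENNReal.toReal_ofReal (sq_nonneg _)]
    using ENNReal.summable_toReal (htsum.trans_ne hA)

variable [CompleteSpace H] [CompleteSpace K]

theorem hilbertSchmidtSq_adjoint (b : HilbertBasis ι 𝕜 H) (c : HilbertBasis κ 𝕜 K)
    (A : H →L[𝕜] K) : hilbertSchmidtSq c A.adjoint = hilbertSchmidtSq b A := by
  simp only [hilbertSchmidtSq]
  simp_rw [← tsum_enorm_inner_sq b, ← tsum_enorm_inner_sq c]
  rw [ENNReal.tsum_comm]
  refine tsum_congr fun k => tsum_congr fun l => ?_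
  rw [ContinuousLinearMap.adjoint_inner_right, ← inner_conj_symm, RCLike.enorm_conj]

/-- Cyclicity of the trace for a product of two Hilbert–Schmidt operators. -/
theorem hasSum_inner_adjoint_adjoint (b : HilbertBasis ι 𝕜 H) (c : HilbertBasis κ 𝕜 K)
    {A B : H →L[𝕜] K} (hA : hilbertSchmidtSq b A ≠ ∞) (hB : hilbertSchmidtSq b B ≠ ∞) :
    HasSum (fun k => ⟪B (b k), A (b k)⟫_𝕜) (∑' l, ⟪A.adjoint (c l), B.adjoint (c l)⟫_𝕜) := by
  have hsummable : Summable fun p : ι × κ => ⟪B (b p.1), c p.2⟫_𝕜 * ⟪c p.2, A (b p.1)⟫_𝕜 := by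
    refine ((summable_norm_inner_sq b c hB).add (summable_norm_inner_sq b c hA)).of_norm_bounded
      fun p => ?_
    rw [norm_mul, norm_inner_symm]
    linarith [two_mul_le_add_sq ‖⟪c p.2, B (b p.1)⟫_𝕜‖ ‖⟪c p.2, A (b p.1)⟫_𝕜‖,
      mul_nonneg (norm_nonneg ⟪c p.2, B (b p.1)⟫_𝕜) (norm_nonneg ⟪c p.2, A (b p.1)⟫_𝕜)]
  have hrows := hsummable.hasSum.prod_fiberwise fun k =>
    c.hasSum_inner_mul_inner (B (b k)) (A (b k))
  have hcols := hsummable.prod_symm.hasSum.prod_fiberwise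
    (g := fun l => ⟪A.adjoint (c l), B.adjoint (c l)⟫_𝕜) fun l => by
      simpa only [ContinuousLinearMap.adjoint_inner_left, ContinuousLinearMap.adjoint_inner_right,
        mul_comm, Prod.swap_prod_mk]
        using b.hasSum_inner_mul_inner (A.adjoint (c l)) (B.adjoint (c l))
  rw [hcols.tsum_eq]
  convert hrows using 1
  exact (Equiv.prodComm κ ι).tsum_eq
    fun p : ι × κ => ⟪B (b p.1), c p.2⟫_𝕜 * ⟪c p.2, A (b p.1)⟫_𝕜

end HilbertSchmidt

section Kraus

variable {H H' K ι ι' α : Type*} [NormedAddCommGroup H] [InnerProductSpace ℂ H] [CompleteSpace H]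
  [NormedAddCommGroup H'] [InnerProductSpace ℂ H'] [CompleteSpace H']
  [NormedAddCommGroup K] [InnerProductSpace ℂ K] [CompleteSpace K] [Fintype α]

theorem norm_operatorSqrt_apply_sq_of_eq_sum {X : α → H' →L[ℂ] H} {ρ : H →L[ℂ] H}
    (hρ : ρ = ∑ a, X a ∘L (X a).adjoint) (φ : H) :
    ‖operatorSqrt ρ φ‖ ^ 2 = ∑ a, ‖(X a).adjoint φ‖ ^ 2 := by
  have hpos : ρ.IsPositive := hρ ▸ ContinuousLinearMap.isPositive_sum _ fun a _ =>
    ContinuousLinearMap.isPositive_self_comp_adjoint (X a)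
  have h : ⟪φ, ρ φ⟫_ℂ = ((‖operatorSqrt ρ φ‖ ^ 2 : ℝ) : ℂ) := by
    rw [inner_apply_eq_inner_operatorSqrt hpos, inner_self_eq_norm_sq_to_K]
    norm_cast
  have hterm (a : α) :
      ⟪φ, (X a ∘L (X a).adjoint) φ⟫_ℂ = ((‖(X a).adjoint φ‖ ^ 2 : ℝ) : ℂ) := by
    rw [ContinuousLinearMap.comp_apply, ← ContinuousLinearMap.adjoint_inner_left,
      inner_self_eq_norm_sq_to_K]
    norm_cast
  conv_lhs at h => rw [hρ, sum_apply, inner_sum]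
  simp only [hterm] at h
  exact_mod_cast h.symm

theorem hilbertSchmidtSq_comp_operatorSqrt_of_eq_sum (b : HilbertBasis ι ℂ H)
    (b' : HilbertBasis ι' ℂ H') {X : α → H' →L[ℂ] H} {ρ : H →L[ℂ] H}
    (hρ : ρ = ∑ a, X a ∘L (X a).adjoint) (T : H →L[ℂ] K) :
    hilbertSchmidtSq b (T ∘L operatorSqrt ρ) = ∑ a, hilbertSchmidtSq b' (T ∘L X a) := by
  obtain ⟨_, c, -⟩ := exists_hilbertBasis ℂ K
  simp only [← hilbertSchmidtSq_adjoint _ c, ContinuousLinearMap.adjoint_comp,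
    adjoint_operatorSqrt]
  simp only [hilbertSchmidtSq, ContinuousLinearMap.comp_apply, enorm_sq_eq_ofReal,
    norm_operatorSqrt_apply_sq_of_eq_sum hρ]
  rw [← Summable.tsum_finsetSum fun _ _ => ENNReal.summable]
  simp only [ENNReal.ofReal_sum_of_nonneg fun _ _ => sq_nonneg _]

end Kraus

section EnergyDistribution

variable {ρ : WeightSpace →L[ℂ] WeightSpace}

theorem IsDensityOperator.hasSum_norm_sq (hρ : IsDensityOperator ρ) :
    HasSum (fun k => ‖operatorSqrt ρ (weightBasis k)‖ ^ 2) 1 := by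
  have h := hρ.hasSum_trace
  simp only [inner_apply_eq_inner_operatorSqrt hρ.isPositive, inner_self_eq_norm_sq_to_K,
    ← RCLike.ofReal_pow] at h
  exact Complex.hasSum_ofReal.1 (by simpa using h)

theorem IsDensityOperator.hilbertSchmidtSq_operatorSqrt (hρ : IsDensityOperator ρ) :
    hilbertSchmidtSq weightBasis (operatorSqrt ρ) = 1 := by
  simp only [hilbertSchmidtSq, enorm_sq_eq_ofReal]
  rw [← ENNReal.ofReal_tsum_of_nonneg (fun _ => sq_nonneg _) hρ.hasSum_norm_sq.summable,
    hρ.hasSum_norm_sq.tsum_eq, ENNReal.ofReal_one]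

theorem enorm_sq_restrict (S : Set ℝ) (φ : WeightSpace) :
    ‖LpToLpRestrictCLM ℝ ℂ ℂ volume 2 S φ‖ₑ ^ 2 = energyMeasure φ S := by
  rw [enorm_sq_eq_lintegral, energyMeasure, withDensity_apply' _ S]
  exact lintegral_congr_ae ((LpToLpRestrictCLM_coeFn ℂ S φ).mono fun E hE => by simp only [hE])

theorem energyDistribution_eq_sum {α : Type*} [Fintype α]
    {X : α → WeightSpace →L[ℂ] WeightSpace} (hρ : ρ = ∑ a, X a ∘L (X a).adjoint) :
    energyDistribution ρ = ∑ a, Measure.sum fun k => energyMeasure (X a (weightBasis k)) := by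
  ext S hS
  have h := hilbertSchmidtSq_comp_operatorSqrt_of_eq_sum weightBasis weightBasis hρ
    (LpToLpRestrictCLM ℝ ℂ ℂ volume 2 S)
  simp only [hilbertSchmidtSq, ContinuousLinearMap.comp_apply, enorm_sq_restrict] at h
  simp only [Measure.finsetSum_apply, Measure.sum_apply _ hS]
  exact (Measure.sum_apply _ hS).trans h

end EnergyDistribution

section OperatorMatrices

variable {𝕜 H n : Type*} [RCLike 𝕜] [NormedAddCommGroup H] [InnerProductSpace 𝕜 H] [Fintype n]

/-- The action of a matrix of operators on `Hⁿ`; for `H = L²(ℝ)` this is how a composite operator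
acts on `ℂⁿ ⊗ L²(ℝ)`. -/
def operatorMulVec (A : Matrix n n (H →L[𝕜] H)) (x : n → H) : n → H :=
  fun i => ∑ j, A i j (x j)

theorem operatorMulVec_mul (A B : Matrix n n (H →L[𝕜] H)) (x : n → H) :
    operatorMulVec (A * B) x = operatorMulVec A (operatorMulVec B x) := by
  ext1 i
  simp only [operatorMulVec, Matrix.mul_apply, sum_apply, mul_apply_eq_comp, map_sum]
  exact Finset.sum_comm

theorem operatorMulVec_diagonal [DecidableEq n] (d : n → H →L[𝕜] H) (x : n → H) (i : n) :
    operatorMulVec (Matrix.diagonal d) x i = d i (x i) := by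
  rw [operatorMulVec, Finset.sum_eq_single i]
  · rw [Matrix.diagonal_apply_eq]
  · intro j _ hj
    rw [Matrix.diagonal_apply_ne' _ hj, zero_apply]
  · simp

variable [CompleteSpace H]

theorem sum_inner_operatorMulVec_left (A : Matrix n n (H →L[𝕜] H)) (x y : n → H) :
    ∑ i, ⟪operatorMulVec A x i, y i⟫_𝕜 = ∑ j, ⟪x j, operatorMulVec (star A) y j⟫_𝕜 := by
  simp only [operatorMulVec, sum_inner, inner_sum, Matrix.star_apply,
    ContinuousLinearMap.star_eq_adjoint, ContinuousLinearMap.adjoint_inner_right]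
  exact Finset.sum_comm

end OperatorMatrices

section Transport

theorem charFun_energyMeasure (φ : WeightSpace) (t : ℝ) :
    charFun (energyMeasure φ) t = ⟪φ, weightPhase t φ⟫_ℂ := by
  have hfinite : ∀ᵐ E, ‖φ E‖ₑ ^ 2 < ∞ := .of_forall fun E => ENNReal.pow_lt_top enorm_lt_top
  rw [charFun_apply_real, energyMeasure, integral_withDensity_eq_integral_toReal_smul
    (measurable_enorm_sq_coeFn φ) hfinite, L2.inner_def]
  refine integral_congr_ae ?_
  filter_upwards [weightPhase_apply t φ] with E hE
  have hphase : (t : ℂ) * E * Complex.I = Complex.I * t * E := by ring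
  rw [hE, RCLike.inner_apply, mul_assoc (Complex.exp _), RCLike.mul_conj, hphase,
    ENNReal.toReal_pow, toReal_enorm, Complex.real_smul, mul_comm, Complex.ofReal_pow]
  rfl

variable {n : Type*} [Fintype n] {ε : n → ℝ}

/-- The distribution of the total energy `H_S + H_W` in the, not necessarily normalised, vector
`∑ i, |ε i⟩ ⊗ x i`. -/
def totalEnergyMeasure (ε : n → ℝ) (x : n → WeightSpace) : Measure ℝ :=
  ∑ i, (energyMeasure (x i)).map (· + ε i)

theorem sum_energyMeasure_compl_ball_le {D : ℝ} (hD : ∀ i, |ε i| ≤ D) (m L : ℝ)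
    (x : n → WeightSpace) :
    ∑ i, energyMeasure (x i) (Metric.ball m (L + D))ᶜ
      ≤ totalEnergyMeasure ε x (Metric.ball m L)ᶜ := by
  rw [totalEnergyMeasure, Measure.finsetSum_apply]
  refine Finset.sum_le_sum fun i _ => ?_
  rw [Measure.map_apply (by fun_prop) Metric.isOpen_ball.measurableSet.compl]
  refine measure_mono fun E hE => ?_
  simp only [Set.mem_compl_iff, Set.mem_preimage, Metric.mem_ball, Real.dist_eq, not_lt] at hE ⊢
  have := abs_add_le (E + ε i - m) (-ε i)
  rw [show E + ε i - m + -ε i = E - m by ring, abs_neg] at this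
  linarith [hD i]

theorem totalEnergyMeasure_compl_ball_le {D : ℝ} (hD : ∀ i, |ε i| ≤ D) (m L : ℝ)
    (x : n → WeightSpace) :
    totalEnergyMeasure ε x (Metric.ball m (L + D))ᶜ
      ≤ ∑ i, energyMeasure (x i) (Metric.ball m L)ᶜ := by
  rw [totalEnergyMeasure, Measure.finsetSum_apply]
  refine Finset.sum_le_sum fun i _ => ?_
  rw [Measure.map_apply (by fun_prop) Metric.isOpen_ball.measurableSet.compl]
  refine measure_mono fun E hE => ?_
  simp only [Set.mem_compl_iff, Set.mem_preimage, Metric.mem_ball, Real.dist_eq, not_lt] at hE ⊢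
  have := abs_add_le (E - m) (ε i)
  rw [show E - m + ε i = E + ε i - m by ring] at this
  linarith [hD i]

theorem energyDistribution_partialTraceSystem (Y : CompositeOperator n) :
    energyDistribution (partialTraceSystem (Y * star Y))
      = ∑ l, ∑ i, Measure.sum fun k => energyMeasure (Y i l (weightBasis k)) := by
  rw [energyDistribution_eq_sum (α := n × n) (X := fun a => Y a.1 a.2), Fintype.sum_prod_type_right]
  rw [partialTraceSystem, Fintype.sum_prod_type]
  rfl

theorem partialTraceSystem_tensor (A : Matrix n n ℂ) (B : WeightSpace →L[ℂ] WeightSpace) :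
    partialTraceSystem (tensor A B) = A.trace • B := by
  simp only [partialTraceSystem, tensor, Matrix.of_apply, ← Finset.sum_smul]
  rfl

open scoped MatrixOrder Matrix.Norms.L2Operator in
theorem exists_tensor_eq_mul_star {A : Matrix n n ℂ} (hA : A.PosSemidef)
    {B : WeightSpace →L[ℂ] WeightSpace} (hB : B.IsPositive) :
    ∃ Y : CompositeOperator n, tensor A B = Y * star Y := by
  classical
  obtain ⟨C, hC⟩ := CStarAlgebra.nonneg_iff_eq_star_mul_self.1 hA.nonneg
  refine ⟨tensor (star C) (operatorSqrt B), ?_⟩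
  have hsqrt : star (operatorSqrt B) = operatorSqrt B := adjoint_operatorSqrt B
  ext1 i j
  simp only [tensor, Matrix.mul_apply, Matrix.star_apply, Matrix.of_apply, star_smul, hsqrt,
    smul_mul_smul_comm, operatorSqrt_mul_self hB, ← Finset.sum_smul, hC, star_star]

variable [DecidableEq n] {U : CompositeOperator n}

theorem charFun_totalEnergyMeasure (ε : n → ℝ) (x : n → WeightSpace) (t : ℝ) :
    charFun (totalEnergyMeasure ε x) t
      = ∑ i, ⟪x i, operatorMulVec (freeEvolution ε t) x i⟫_ℂ := by
  rw [totalEnergyMeasure, charFun_eq_integral_innerProbChar, integral_finsetSum_measure fun i _ =>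
    (BoundedContinuousFunction.innerProbChar t).integrable _]
  refine Finset.sum_congr rfl fun i _ => ?_
  rw [← charFun_eq_integral_innerProbChar, charFun_map_add_const, charFun_energyMeasure,
    freeEvolution, operatorMulVec_diagonal, smul_apply, inner_smul_right, mul_comm]
  congr 2
  rw [Real.inner_apply]
  push_cast
  ring

theorem totalEnergyMeasure_operatorMulVec (hU : star U * U = 1)
    (hcomm : ∀ s, Commute U (freeEvolution ε s)) (x : n → WeightSpace) :
    totalEnergyMeasure ε (operatorMulVec U x) = totalEnergyMeasure ε x := by
  have hfinite (y : n → WeightSpace) : IsFiniteMeasure (totalEnergyMeasure ε y) := by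
    unfold totalEnergyMeasure
    infer_instance
  refine Measure.ext_of_charFun (funext fun t => ?_)
  rw [charFun_totalEnergyMeasure, charFun_totalEnergyMeasure, ← operatorMulVec_mul, ← (hcomm t).eq,
    sum_inner_operatorMulVec_left, ← operatorMulVec_mul, ← mul_assoc, hU, one_mul]

theorem energyDistribution_partialTraceSystem_le (hU : star U * U = 1)
    (hcomm : ∀ s, Commute U (freeEvolution ε s)) (Y : CompositeOperator n) {D : ℝ}
    (hD : ∀ i, |ε i| ≤ D) (m L : ℝ) :
    energyDistribution (partialTraceSystem (Y * star Y)) (Metric.ball m (L + D + D))ᶜ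
      ≤ energyDistribution (partialTraceSystem (U * Y * star (U * Y))) (Metric.ball m L)ᶜ := by
  have hmeas (r : ℝ) : MeasurableSet (Metric.ball m r)ᶜ := Metric.isOpen_ball.measurableSet.compl
  simp only [energyDistribution_partialTraceSystem, Measure.finsetSum_apply,
    Measure.sum_apply _ (hmeas _)]
  refine Finset.sum_le_sum fun l _ => ?_
  rw [← Summable.tsum_finsetSum fun _ _ => ENNReal.summable,
    ← Summable.tsum_finsetSum fun _ _ => ENNReal.summable]
  refine ENNReal.tsum_le_tsum fun k => ?_
  set x : n → WeightSpace := fun j => Y j l (weightBasis k)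
  have hx (i : n) : (U * Y) i l (weightBasis k) = operatorMulVec U x i := by
    simp only [Matrix.mul_apply, sum_apply, mul_apply_eq_comp, operatorMulVec, x]
  simp only [hx]
  calc ∑ i, energyMeasure (x i) (Metric.ball m (L + D + D))ᶜ
      ≤ totalEnergyMeasure ε x (Metric.ball m (L + D))ᶜ :=
        sum_energyMeasure_compl_ball_le hD m (L + D) x
    _ = totalEnergyMeasure ε (operatorMulVec U x) (Metric.ball m (L + D))ᶜ := by
        rw [totalEnergyMeasure_operatorMulVec hU hcomm]
    _ ≤ ∑ i, energyMeasure (operatorMulVec U x i) (Metric.ball m L)ᶜ :=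
        totalEnergyMeasure_compl_ball_le hD m L _

theorem energyDistribution_le_finalWeightState {ρS : Matrix n n ℂ} (hρS : IsDensityMatrix ρS)
    {ρW : WeightSpace →L[ℂ] WeightSpace} (hρW : ρW.IsPositive) (hU : star U * U = 1)
    (hcomm : ∀ s, Commute U (freeEvolution ε s)) {D : ℝ} (hD : ∀ i, |ε i| ≤ D) (m L : ℝ) :
    energyDistribution ρW (Metric.ball m (L + D + D))ᶜ
      ≤ energyDistribution (finalWeightState U ρS ρW) (Metric.ball m L)ᶜ := by
  obtain ⟨Y, hY⟩ := exists_tensor_eq_mul_star hρS.posSemidef hρW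
  have hinitial : partialTraceSystem (Y * star Y) = ρW := by
    rw [← hY, partialTraceSystem_tensor, hρS.trace_eq_one, one_smul]
  have hfinal : finalWeightState U ρS ρW = partialTraceSystem (U * Y * star (U * Y)) := by
    rw [finalWeightState, hY, star_mul]
    simp only [mul_assoc]
  simpa only [hinitial, hfinal]
    using energyDistribution_partialTraceSystem_le hU hcomm Y hD m L

end Transport

section DoublyStochastic

variable {n : Type*} [Fintype n]

theorem le_dotProduct_mulVec_of_mem_doublyStochastic [DecidableEq n] {M : Matrix n n ℝ}
    (hM : M ∈ doublyStochastic ℝ n) {x y : n → ℝ} {c : ℝ}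
    (hc : ∀ π : Equiv.Perm n, c ≤ ∑ l, x (π l) * y l) : c ≤ x ⬝ᵥ M *ᵥ y := by
  have hlinear : IsLinearMap ℝ fun M : Matrix n n ℝ => x ⬝ᵥ M *ᵥ y :=
    ⟨fun M N => by rw [Matrix.add_mulVec, dotProduct_add],
      fun a M => by rw [Matrix.smul_mulVec, dotProduct_smul]⟩
  rw [← SetLike.mem_coe, doublyStochastic_eq_convexHull_permMatrix] at hM
  refine convexHull_min ?_ (convex_halfSpace_ge hlinear c) hM
  rintro _ ⟨π, rfl⟩
  have hperm : x ⬝ᵥ π.permMatrix ℝ *ᵥ y = ∑ l, x (π⁻¹ l) * y l := by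
    rw [Matrix.permMatrix_mulVec, dotProduct, ← Equiv.sum_comp π fun l => x (π⁻¹ l) * y l]
    simp
  exact (hc π⁻¹).trans_eq hperm.symm

theorem mul_le_dotProduct_mulVec {M : Matrix n n ℝ} (hM : ∀ i j, 0 ≤ M i j) {t : ℝ} (ht : 0 ≤ t)
    (hrow : ∀ i, ∑ j, M i j = t) (hcol : ∀ j, ∑ i, M i j = t) {x y : n → ℝ} {c : ℝ}
    (hc : ∀ π : Equiv.Perm n, c ≤ ∑ l, x (π l) * y l) : c * t ≤ x ⬝ᵥ M *ᵥ y := by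
  classical
  obtain ⟨N, hN, rfl⟩ := (exists_mem_doublyStochastic_eq_smul_iff ht).2 ⟨hM, hrow, hcol⟩
  rw [Matrix.smul_mulVec, dotProduct_smul, smul_eq_mul, mul_comm]
  gcongr
  exact le_dotProduct_mulVec_of_mem_doublyStochastic hN hc

end DoublyStochastic

section Diagonalization

variable {𝕜 n : Type*} [RCLike 𝕜] [Fintype n] [DecidableEq n]

theorem submatrix_mem_unitaryGroup {m : Type*} [Fintype m] [DecidableEq m] {A : Matrix n n 𝕜}
    (hA : A ∈ Matrix.unitaryGroup n 𝕜) (e f : m ≃ n) :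
    A.submatrix e f ∈ Matrix.unitaryGroup m 𝕜 := by
  rw [Matrix.mem_unitaryGroup_iff, Matrix.star_eq_conjTranspose] at hA ⊢
  rw [Matrix.conjTranspose_submatrix, Matrix.submatrix_mul_equiv, hA, Matrix.submatrix_one_equiv]

theorem blockDiagonal'_mem_unitaryGroup {o : Type*} [Fintype o] [DecidableEq o] {m : o → Type*}
    [∀ k, Fintype (m k)] [∀ k, DecidableEq (m k)] {A : ∀ k, Matrix (m k) (m k) 𝕜}
    (hA : ∀ k, A k ∈ Matrix.unitaryGroup (m k) 𝕜) :
    Matrix.blockDiagonal' A ∈ Matrix.unitaryGroup (Σ k, m k) 𝕜 := by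
  simp only [Matrix.mem_unitaryGroup_iff, Matrix.star_eq_conjTranspose] at hA ⊢
  rw [Matrix.blockDiagonal'_conjTranspose, ← Matrix.blockDiagonal'_mul]
  simp only [hA]
  exact Matrix.blockDiagonal'_one

variable {ρ : Matrix n n 𝕜}

theorem exists_unitary_diagonalization (hρ : ρ.IsHermitian) :
    ∃ A ∈ Matrix.unitaryGroup n 𝕜, ∃ r : n → ℝ,
      ρ = A * Matrix.diagonal (fun l => (r l : 𝕜)) * Aᴴ :=
  ⟨hρ.eigenvectorUnitary, hρ.eigenvectorUnitary.2, hρ.eigenvalues, hρ.spectral_theorem⟩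

theorem exists_unitary_diagonalization_of_forall_ne {κ : Type*} (f : n → κ) (hρ : ρ.IsHermitian)
    (hf : ∀ i j, f i ≠ f j → ρ i j = 0) :
    ∃ A ∈ Matrix.unitaryGroup n 𝕜, (∀ i j, f i ≠ f j → A i j = 0) ∧ ∃ r : n → ℝ,
      ρ = A * Matrix.diagonal (fun l => (r l : 𝕜)) * Aᴴ := by
  classical
  set g : n → Set.range f := Set.rangeFactorization f
  have hg {i j : n} (h : f i ≠ f j) : g i ≠ g j := fun h' => h (congrArg Subtype.val h')
  set e : (Σ k, {i // g i = k}) ≃ n := Equiv.sigmaFiberEquiv g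
  have hB (k : Set.range f) :
      (ρ.submatrix Subtype.val Subtype.val : Matrix {i // g i = k} {i // g i = k} 𝕜).IsHermitian :=
    hρ.submatrix _
  choose W hW r hr using fun k => exists_unitary_diagonalization (hB k)
  have hblock : ρ.submatrix e e = Matrix.blockDiagonal' fun k =>
      ρ.submatrix Subtype.val Subtype.val := by
    ext ⟨k, i⟩ ⟨l, j⟩
    by_cases hkl : k = l
    · subst hkl
      rw [Matrix.blockDiagonal'_apply_eq]
      rfl
    · rw [Matrix.blockDiagonal'_apply_ne _ _ _ hkl]
      refine hf _ _ fun h => hkl ?_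
      rw [← i.2, ← j.2]
      exact Subtype.ext h
  refine ⟨(Matrix.blockDiagonal' W).submatrix e.symm e.symm,
    submatrix_mem_unitaryGroup (blockDiagonal'_mem_unitaryGroup hW) _ _, fun i j hij => ?_,
    fun i => r (e.symm i).1 (e.symm i).2, ?_⟩
  · exact Matrix.blockDiagonal'_apply_ne W _ _ (hg hij)
  · calc ρ = (ρ.submatrix e e).submatrix e.symm e.symm := by simp
      _ = _ := by
        rw [hblock]
        simp_rw [hr]
        rw [Matrix.blockDiagonal'_mul, Matrix.blockDiagonal'_mul, Matrix.blockDiagonal'_diagonal,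
          ← Matrix.blockDiagonal'_conjTranspose, Matrix.conjTranspose_submatrix,
          ← Matrix.submatrix_mul_equiv _ _ _ e.symm, ← Matrix.submatrix_mul_equiv _ _ _ e.symm,
          Matrix.submatrix_diagonal_equiv]
        rfl

end Diagonalization

section RotatedHamiltonian

variable {n : Type*} [Fintype n] [DecidableEq n]

/-- The rotated Hamiltonian `V† H_S V`, whose mean energy in a state `ρ` is the energy of `ρ` after
the unitary `V`. -/
def rotatedHamiltonian (ε : n → ℝ) (V : Matrix n n ℂ) : Matrix n n ℂ :=
  Vᴴ * systemHamiltonian ε * V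

theorem norm_rotatedHamiltonian_apply_le (ε : n → ℝ) {V : Matrix n n ℂ}
    (hV : V ∈ Matrix.unitaryGroup n ℂ) (i j : n) :
    ‖rotatedHamiltonian ε V i j‖ ≤ ∑ k, |ε k| := by
  rw [rotatedHamiltonian, systemHamiltonian, Matrix.mul_apply]
  refine norm_sum_le_of_le _ fun k _ => ?_
  rw [Matrix.mul_diagonal, Matrix.conjTranspose_apply, norm_mul, norm_mul, norm_star,
    Complex.norm_real, Real.norm_eq_abs]
  calc ‖V k i‖ * |ε k| * ‖V k j‖ ≤ 1 * |ε k| * 1 := by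
        gcongr <;> exact entry_norm_bound_of_unitary hV _ _
    _ = |ε k| := by ring

theorem norm_trace_rotatedHamiltonian_mul_le (ε : n → ℝ) {V : Matrix n n ℂ}
    (hV : V ∈ Matrix.unitaryGroup n ℂ) (ρ : Matrix n n ℂ) :
    ‖(rotatedHamiltonian ε V * ρ).trace‖ ≤ ∑ i, ∑ j, (∑ k, |ε k|) * ‖ρ j i‖ := by
  rw [Matrix.trace]
  refine norm_sum_le_of_le _ fun i _ => norm_sum_le_of_le _ fun j _ => ?_
  rw [norm_mul]
  gcongr
  exact norm_rotatedHamiltonian_apply_le ε hV i j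

theorem trace_workOperator_mul (ε : n → ℝ) (V ρ : Matrix n n ℂ) :
    (workOperator ε V * ρ).trace
      = (systemHamiltonian ε * ρ).trace - (rotatedHamiltonian ε V * ρ).trace := by
  rw [workOperator, sub_mul, Matrix.trace_sub, rotatedHamiltonian]

theorem bddAbove_trace_workOperator_mul (ε : n → ℝ) (ρ : Matrix n n ℂ) :
    BddAbove (Set.range fun V : Matrix.unitaryGroup n ℂ =>
      ((workOperator ε (V : Matrix n n ℂ) * ρ).trace).re) := by
  refine ⟨((systemHamiltonian ε * ρ).trace).re + ∑ i, ∑ j, (∑ k, |ε k|) * ‖ρ j i‖, ?_⟩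
  rintro _ ⟨V, rfl⟩
  simp only [trace_workOperator_mul, Complex.sub_re]
  have hre := Complex.abs_re_le_norm (rotatedHamiltonian ε (V : Matrix n n ℂ) * ρ).trace
  linarith [neg_le_of_abs_le (hre.trans (norm_trace_rotatedHamiltonian_mul_le ε V.2 ρ))]

theorem le_ergotropy (ε : n → ℝ) {V : Matrix n n ℂ} (hV : V ∈ Matrix.unitaryGroup n ℂ)
    (ρ : Matrix n n ℂ) : ((workOperator ε V * ρ).trace).re ≤ ergotropy ε ρ :=
  le_ciSup (bddAbove_trace_workOperator_mul ε ρ) ⟨V, hV⟩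

theorem le_incoherentErgotropy {ε : n → ℝ} {V : Matrix n n ℂ}
    (hV : V ∈ Matrix.unitaryGroup n ℂ) (hcomm : Commute (workOperator ε V) (systemHamiltonian ε))
    (ρ : Matrix n n ℂ) : ((workOperator ε V * ρ).trace).re ≤ incoherentErgotropy ε ρ :=
  le_ciSup (f := fun V : {V : Matrix.unitaryGroup n ℂ //
      Commute (workOperator ε (V : Matrix n n ℂ)) (systemHamiltonian ε)} =>
      ((workOperator ε V.1.1 * ρ).trace).re)
    ((bddAbove_trace_workOperator_mul ε ρ).mono
      (Set.range_subset_iff.2 fun V => Set.mem_range_self V.1))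
    ⟨⟨V, hV⟩, hcomm⟩

theorem ergotropy_le {ε : n → ℝ} {ρ : Matrix n n ℂ} {c : ℝ}
    (h : ∀ V ∈ Matrix.unitaryGroup n ℂ, ((workOperator ε V * ρ).trace).re ≤ c) :
    ergotropy ε ρ ≤ c :=
  ciSup_le fun V => h V.1 V.2

theorem exists_rotatedHamiltonian_eq (ε : n → ℝ) {A : Matrix n n ℂ}
    (hA : A ∈ Matrix.unitaryGroup n ℂ) (π : Equiv.Perm n) :
    ∃ V ∈ Matrix.unitaryGroup n ℂ,
      rotatedHamiltonian ε V = A * Matrix.diagonal (fun l => (ε (π l) : ℂ)) * Aᴴ := by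
  refine ⟨Aᴴ.submatrix π.symm (Equiv.refl n),
    submatrix_mem_unitaryGroup (Unitary.star_mem hA) _ _, ?_⟩
  have hdiag : systemHamiltonian ε
      = (Matrix.diagonal fun l => (ε (π l) : ℂ)).submatrix π.symm π.symm := by
    rw [Matrix.submatrix_diagonal_equiv, systemHamiltonian]
    simp only [Function.comp_def, Equiv.apply_symm_apply]
  rw [rotatedHamiltonian, hdiag, Matrix.conjTranspose_submatrix, Matrix.conjTranspose_conjTranspose,
    Matrix.submatrix_mul_equiv, Matrix.submatrix_mul_equiv]
  rfl

theorem trace_conj_diagonal_mul_conj_diagonal {A : Matrix n n ℂ}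
    (hA : A ∈ Matrix.unitaryGroup n ℂ) (f r : n → ℂ) :
    ((A * Matrix.diagonal f * Aᴴ) * (A * Matrix.diagonal r * Aᴴ)).trace = ∑ l, f l * r l := by
  have hAA : Aᴴ * A = 1 := Matrix.mem_unitaryGroup_iff'.1 hA
  calc ((A * Matrix.diagonal f * Aᴴ) * (A * Matrix.diagonal r * Aᴴ)).trace
      = (A * Matrix.diagonal f * (Aᴴ * A) * Matrix.diagonal r * Aᴴ).trace := by
        simp only [mul_assoc]
    _ = (A * (Matrix.diagonal f * Matrix.diagonal r) * Aᴴ).trace := by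
        rw [hAA, mul_one, mul_assoc A]
    _ = ∑ l, f l * r l := by
        rw [Matrix.trace_mul_cycle, hAA, one_mul, Matrix.diagonal_mul_diagonal,
          Matrix.trace_diagonal]

end RotatedHamiltonian

section TransitionWeight

variable {𝕜 E n : Type*} [RCLike 𝕜] [NormedAddCommGroup E] [InnerProductSpace 𝕜 E] [Fintype n]

theorem sum_inner_sum_smul {m p : Type*} [Fintype m] [Fintype p] (A : Matrix m n 𝕜)
    (B : Matrix m p 𝕜) (x : n → E) (y : p → E) :
    ∑ i, ⟪∑ j, A i j • x j, ∑ k, B i k • y k⟫_𝕜 = ∑ j, ∑ k, (Aᴴ * B) j k * ⟪x j, y k⟫_𝕜 := by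
  simp only [sum_inner, inner_sum, inner_smul_left, inner_smul_right, Matrix.mul_apply,
    Matrix.conjTranspose_apply, Finset.sum_mul, Finset.mul_sum]
  rw [Finset.sum_comm]
  refine .trans ?_ Finset.sum_comm
  refine Finset.sum_congr rfl fun k _ => .trans Finset.sum_comm ?_
  refine Finset.sum_congr rfl fun j _ => Finset.sum_congr rfl fun i _ => ?_
  rw [starRingEnd_apply]
  ring

/-- The matrix `‖∑ i, V k i A i l v i‖²`. For unitary `V` and `A` and vectors `v i` of equal length
it is doubly stochastic up to a factor; for `v = 1` in `ℂ` its entries are the transition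
probabilities `|⟨k| V A |l⟩|²`. -/
def transitionWeight (V A : Matrix n n 𝕜) (v : n → E) : Matrix n n ℝ :=
  Matrix.of fun k l => ‖∑ i, (V k i * A i l) • v i‖ ^ 2

variable [DecidableEq n]

theorem sum_norm_sq_sum_smul {V : Matrix n n 𝕜} (hV : V ∈ Matrix.unitaryGroup n 𝕜) (x : n → E) :
    ∑ i, ‖∑ j, V i j • x j‖ ^ 2 = ∑ j, ‖x j‖ ^ 2 := by
  have h := sum_inner_sum_smul V V x x
  have hVV : Vᴴ * V = 1 := Matrix.mem_unitaryGroup_iff'.1 hV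
  simp only [hVV, Matrix.one_apply, ite_mul, one_mul, zero_mul, Finset.sum_ite_eq, Finset.mem_univ,
    if_true, inner_self_eq_norm_sq_to_K] at h
  exact_mod_cast h

theorem sum_norm_sq_apply {A : Matrix n n 𝕜} (hA : A ∈ Matrix.unitaryGroup n 𝕜) (l : n) :
    ∑ i, ‖A i l‖ ^ 2 = 1 := by
  simpa [Pi.single_apply, apply_ite norm, ite_pow] using
    sum_norm_sq_sum_smul hA (Pi.single l (1 : 𝕜))

theorem sum_transitionWeight_col {V A : Matrix n n 𝕜} (hV : V ∈ Matrix.unitaryGroup n 𝕜)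
    (hA : A ∈ Matrix.unitaryGroup n 𝕜) {v : n → E} {t : ℝ} (hv : ∀ i, ‖v i‖ ^ 2 = t) (l : n) :
    ∑ k, transitionWeight V A v k l = t := by
  calc ∑ k, transitionWeight V A v k l = ∑ k, ‖∑ i, V k i • A i l • v i‖ ^ 2 := by
        simp only [transitionWeight, Matrix.of_apply, smul_smul]
    _ = ∑ i, ‖A i l • v i‖ ^ 2 := sum_norm_sq_sum_smul hV _
    _ = (∑ i, ‖A i l‖ ^ 2) * t := by simp only [norm_smul, mul_pow, hv, Finset.sum_mul]
    _ = t := by rw [sum_norm_sq_apply hA, one_mul]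

theorem sum_transitionWeight_row {V A : Matrix n n 𝕜} (hV : V ∈ Matrix.unitaryGroup n 𝕜)
    (hA : A ∈ Matrix.unitaryGroup n 𝕜) {v : n → E} {t : ℝ} (hv : ∀ i, ‖v i‖ ^ 2 = t) (k : n) :
    ∑ l, transitionWeight V A v k l = t := by
  rw [← sum_transitionWeight_col (Matrix.transpose_mem_unitaryGroup_iff.2 hA)
    (Matrix.transpose_mem_unitaryGroup_iff.2 hV) hv k]
  simp only [transitionWeight, Matrix.of_apply, Matrix.transpose_apply, mul_comm]

end TransitionWeight

section MeanEnergy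

variable {n E : Type*} [Fintype n] [DecidableEq n] [NormedAddCommGroup E] [InnerProductSpace ℂ E]

theorem sum_rotatedHamiltonian_mul_inner (ε r : n → ℝ) (V A : Matrix n n ℂ) (v : n → E) :
    ∑ i, ∑ j, rotatedHamiltonian ε V i j
        * (A * Matrix.diagonal (fun l => (r l : ℂ)) * Aᴴ) j i * ⟪v i, v j⟫_ℂ
      = ((ε ⬝ᵥ transitionWeight V A v *ᵥ r : ℝ) : ℂ) := by
  have hcol : ∀ l, ∑ i, ∑ j, rotatedHamiltonian ε V i j * ⟪A i l • v i, A j l • v j⟫_ℂ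
      = ((∑ k, ε k * transitionWeight V A v k l : ℝ) : ℂ) := fun l => by
    rw [rotatedHamiltonian, mul_assoc, ← sum_inner_sum_smul, Complex.ofReal_sum]
    refine Finset.sum_congr rfl fun k _ => ?_
    simp only [systemHamiltonian, Matrix.diagonal_mul, mul_smul, ← Finset.smul_sum]
    rw [inner_smul_right, inner_self_eq_norm_sq_to_K]
    simp [transitionWeight, mul_smul]
  have hentry : ∀ i j, (A * Matrix.diagonal (fun l => (r l : ℂ)) * Aᴴ) j i
      = ∑ l, A j l * r l * star (A i l) := fun i j => by
    rw [Matrix.mul_apply]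
    simp only [Matrix.mul_diagonal, Matrix.conjTranspose_apply]
  calc _ = ∑ l, r l * ∑ i, ∑ j, rotatedHamiltonian ε V i j * ⟪A i l • v i, A j l • v j⟫_ℂ := by
        simp only [hentry, inner_smul_left, inner_smul_right, Finset.mul_sum, Finset.sum_mul]
        refine .trans (Finset.sum_congr rfl fun i _ => Finset.sum_comm) (Finset.sum_comm.trans ?_)
        refine Finset.sum_congr rfl fun l _ => Finset.sum_congr rfl fun i _ =>
          Finset.sum_congr rfl fun j _ => ?_
        rw [starRingEnd_apply]
        ring
    _ = ∑ l, r l * ((∑ k, ε k * transitionWeight V A v k l : ℝ) : ℂ) := by simp only [hcol]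
    _ = _ := by
        rw [Matrix.dotProduct_mulVec]
        simp [dotProduct, Matrix.vecMul, mul_comm]

theorem mul_le_sum_rotatedHamiltonian_mul_inner {ε r : n → ℝ} {V A : Matrix n n ℂ}
    (hV : V ∈ Matrix.unitaryGroup n ℂ) (hA : A ∈ Matrix.unitaryGroup n ℂ) {c : ℝ}
    (hc : ∀ π : Equiv.Perm n, c ≤ ∑ l, ε (π l) * r l) {v : n → E} {t : ℝ} (ht : 0 ≤ t)
    (hv : ∀ i, ‖v i‖ ^ 2 = t) :
    ((c * t : ℝ) : ℂ) ≤ ∑ i, ∑ j, rotatedHamiltonian ε V i j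
        * (A * Matrix.diagonal (fun l => (r l : ℂ)) * Aᴴ) j i * ⟪v i, v j⟫_ℂ := by
  rw [sum_rotatedHamiltonian_mul_inner, Complex.real_le_real]
  exact mul_le_dotProduct_mulVec (fun k l => sq_nonneg _) ht (sum_transitionWeight_row hV hA hv)
    (sum_transitionWeight_col hV hA hv) hc

end MeanEnergy

section CoherentErgotropy

variable {n : Type*} [Fintype n] [DecidableEq n]

theorem commute_systemHamiltonian_iff {ε : n → ℝ} {A : Matrix n n ℂ} :
    Commute A (systemHamiltonian ε) ↔ ∀ i j, ε i ≠ ε j → A i j = 0 := by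
  rw [commute_iff_eq, ← Matrix.ext_iff]
  refine forall_congr' fun i => forall_congr' fun j => ?_
  rw [systemHamiltonian, Matrix.mul_diagonal, Matrix.diagonal_mul, mul_comm, eq_comm, ← sub_eq_zero,
    ← sub_mul, mul_eq_zero, sub_eq_zero, Complex.ofReal_inj, or_iff_not_imp_left]

/-- The state `ρ` dephased in the energy eigenspaces of the system. -/
def dephased (ε : n → ℝ) (ρ : Matrix n n ℂ) : Matrix n n ℂ :=
  Matrix.of fun i j => if ε i = ε j then ρ i j else 0

theorem trace_mul_dephased {ε : n → ℝ} {A : Matrix n n ℂ}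
    (hA : Commute A (systemHamiltonian ε)) (ρ : Matrix n n ℂ) :
    (A * dephased ε ρ).trace = (A * ρ).trace := by
  rw [commute_systemHamiltonian_iff] at hA
  simp only [Matrix.trace, Matrix.diag_apply, Matrix.mul_apply, dephased, Matrix.of_apply]
  refine Finset.sum_congr rfl fun i _ => Finset.sum_congr rfl fun j _ => ?_
  split_ifs with h
  · rfl
  · rw [hA i j (Ne.symm h), zero_mul, zero_mul]

/-- The passive energy of `ρ`: the minimal mean energy that is reached from `ρ` by unitaries. -/
def passiveEnergy (ε : n → ℝ) (ρ : Matrix n n ℂ) : ℝ :=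
  ((systemHamiltonian ε * ρ).trace).re - ergotropy ε ρ

theorem passiveEnergy_le (ε : n → ℝ) {V : Matrix n n ℂ} (hV : V ∈ Matrix.unitaryGroup n ℂ)
    (ρ : Matrix n n ℂ) : passiveEnergy ε ρ ≤ ((rotatedHamiltonian ε V * ρ).trace).re := by
  have h := le_ergotropy ε hV ρ
  rw [trace_workOperator_mul, Complex.sub_re] at h
  rw [passiveEnergy]
  linarith

theorem passiveEnergy_le_sum_perm (ε r : n → ℝ) {A : Matrix n n ℂ}
    (hA : A ∈ Matrix.unitaryGroup n ℂ) (π : Equiv.Perm n) :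
    passiveEnergy ε (A * Matrix.diagonal (fun l => (r l : ℂ)) * Aᴴ) ≤ ∑ l, ε (π l) * r l := by
  obtain ⟨V, hV, hVA⟩ := exists_rotatedHamiltonian_eq ε hA π
  refine (passiveEnergy_le ε hV _).trans_eq ?_
  rw [hVA, trace_conj_diagonal_mul_conj_diagonal hA, Complex.re_sum]
  simp only [← Complex.ofReal_mul, Complex.ofReal_re]

theorem passiveEnergy_mul_le_sum_inner {E : Type*} [NormedAddCommGroup E]
    [InnerProductSpace ℂ E] (ε : n → ℝ) {ρ V : Matrix n n ℂ} (hρ : ρ.IsHermitian)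
    (hV : V ∈ Matrix.unitaryGroup n ℂ) {v : n → E} {t : ℝ} (ht : 0 ≤ t)
    (hv : ∀ i, ‖v i‖ ^ 2 = t) :
    ((passiveEnergy ε ρ * t : ℝ) : ℂ)
      ≤ ∑ i, ∑ j, rotatedHamiltonian ε V i j * ρ j i * ⟪v i, v j⟫_ℂ := by
  obtain ⟨A, hA, r, rfl⟩ := exists_unitary_diagonalization hρ
  exact mul_le_sum_rotatedHamiltonian_mul_inner hV hA (passiveEnergy_le_sum_perm ε r hA) ht hv

theorem passiveEnergy_add_coherentErgotropy_le (ε : n → ℝ) {V : Matrix n n ℂ}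
    (hV : V ∈ Matrix.unitaryGroup n ℂ) {ρ : Matrix n n ℂ} (hρ : ρ.IsHermitian) :
    ((passiveEnergy ε ρ + coherentErgotropy ε ρ : ℝ) : ℂ)
      ≤ (rotatedHamiltonian ε V * dephased ε ρ).trace := by
  have hdeph : (dephased ε ρ).IsHermitian := by
    ext i j
    simp only [dephased, Matrix.conjTranspose_apply, Matrix.of_apply, eq_comm (a := ε j),
      apply_ite star, hρ.apply, star_zero]
  obtain ⟨A, hA, hAε, r, hr⟩ := exists_unitary_diagonalization_of_forall_ne ε hdeph
    fun i j hij => if_neg hij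
  simp only [RCLike.ofReal_eq_complex_ofReal] at hr
  have hAcomm : Commute A (systemHamiltonian ε) := commute_systemHamiltonian_iff.2 hAε
  have hAcomm' : Commute Aᴴ (systemHamiltonian ε) := by
    rw [commute_systemHamiltonian_iff]
    exact fun i j hij => by rw [Matrix.conjTranspose_apply, hAε j i hij.symm, star_zero]
  have hdiag : ∀ f : n → ℂ, Commute (Matrix.diagonal f) (systemHamiltonian ε) := fun f =>
    Matrix.commute_diagonal _ _
  have hperm : ∀ π : Equiv.Perm n,
      passiveEnergy ε ρ + coherentErgotropy ε ρ ≤ ∑ l, ε (π l) * r l := fun π => by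
    obtain ⟨W, hW, hWA⟩ := exists_rotatedHamiltonian_eq ε hA π
    have hWcomm : Commute (rotatedHamiltonian ε W) (systemHamiltonian ε) := by
      rw [hWA]
      exact (hAcomm.mul_left (hdiag _)).mul_left hAcomm'
    have hle := le_incoherentErgotropy hW ((Commute.refl _).sub_left hWcomm) ρ
    rw [trace_workOperator_mul, Complex.sub_re, ← trace_mul_dephased hWcomm, hWA, hr,
      trace_conj_diagonal_mul_conj_diagonal hA, Complex.re_sum] at hle
    simp only [← Complex.ofReal_mul, Complex.ofReal_re] at hle
    rw [passiveEnergy, coherentErgotropy]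
    linarith
  have h := mul_le_sum_rotatedHamiltonian_mul_inner hV hA hperm (v := fun _ => (1 : ℂ))
    zero_le_one (by simp)
  rw [← hr] at h
  simpa [Matrix.trace, Matrix.mul_apply] using h

end CoherentErgotropy

section Excess

variable {n : Type*} [Fintype n] [DecidableEq n]

/-- The set of energy gaps of the system. -/
def energyGaps (ε : n → ℝ) : Finset ℝ :=
  insert 0 (Finset.univ.image fun p : n × n => ε p.2 - ε p.1)

/-- The symbol of the excess operator: displacements are represented by basis vectors of
`AddMonoidAlgebra ℂ ℝ`, and the expectation of the operator in a pure weight state is the excess of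
the mean energy after the control operator and `V` over the passive energy of `ρ`. -/
def excessSymbol (ε : n → ℝ) (ρ V : Matrix n n ℂ) : AddMonoidAlgebra ℂ ℝ :=
  ∑ i, ∑ j, AddMonoidAlgebra.single (ε j - ε i) (rotatedHamiltonian ε V i j * ρ j i)
    - AddMonoidAlgebra.single 0 (passiveEnergy ε ρ : ℂ)

theorem support_coeff_excessSymbol_subset (ε : n → ℝ) (ρ V : Matrix n n ℂ) :
    (excessSymbol ε ρ V).coeff.support ⊆ energyGaps ε := by
  intro a ha
  by_contra hgap
  rw [energyGaps, Finset.mem_insert, Finset.mem_image, not_or] at hgap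
  have hne : ∀ i j, ε j - ε i ≠ a := fun i j h => hgap.2 ⟨(i, j), Finset.mem_univ _, h⟩
  apply Finsupp.mem_support_iff.1 ha
  simp [excessSymbol, hne, Ne.symm hgap.1]

theorem coeff_zero_excessSymbol (ε : n → ℝ) (ρ V : Matrix n n ℂ) :
    (excessSymbol ε ρ V).coeff 0
      = (rotatedHamiltonian ε V * dephased ε ρ).trace - passiveEnergy ε ρ := by
  simp only [excessSymbol, AddMonoidAlgebra.coeff_sub, AddMonoidAlgebra.coeff_sum,
    AddMonoidAlgebra.coeff_single, Finsupp.sub_apply, Finsupp.finsetSum_apply,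
    Finsupp.single_apply, sub_eq_zero, if_true, Matrix.trace, Matrix.diag_apply, Matrix.mul_apply,
    dephased, Matrix.of_apply, mul_ite, mul_zero]

theorem coherentErgotropy_le_norm_coeff_zero_excessSymbol (ε : n → ℝ) {ρ V : Matrix n n ℂ}
    (hρ : ρ.IsHermitian) (hV : V ∈ Matrix.unitaryGroup n ℂ) :
    coherentErgotropy ε ρ ≤ ‖(excessSymbol ε ρ V).coeff 0‖ := by
  have h := (Complex.le_def.1 (passiveEnergy_add_coherentErgotropy_le ε hV hρ)).1
  refine le_trans ?_ (Complex.re_le_norm _)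
  rw [coeff_zero_excessSymbol, Complex.sub_re, Complex.ofReal_re]
  rw [Complex.ofReal_re] at h
  linarith

theorem displacementHom_excessSymbol (ε : n → ℝ) (ρ V : Matrix n n ℂ) :
    displacementHom (excessSymbol ε ρ V)
      = ∑ i, ∑ j, (rotatedHamiltonian ε V i j * ρ j i) • displacement (ε j - ε i)
        - (passiveEnergy ε ρ : ℂ) • 1 := by
  simp only [excessSymbol, map_sub, map_sum, displacementHom_single, displacement_zero]

theorem norm_displacementHom_excessSymbol_le (ε : n → ℝ) (ρ : Matrix n n ℂ) {V : Matrix n n ℂ}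
    (hV : V ∈ Matrix.unitaryGroup n ℂ) :
    ‖displacementHom (excessSymbol ε ρ V)‖
      ≤ ∑ i, ∑ j, (∑ k, |ε k|) * ‖ρ j i‖ + |passiveEnergy ε ρ| := by
  rw [displacementHom_excessSymbol]
  refine norm_sub_le_of_le
    (norm_sum_le_of_le _ fun i _ => norm_sum_le_of_le _ fun j _ => ?_) ?_
  · rw [norm_smul, norm_mul]
    refine (mul_le_of_le_one_right (by positivity) (norm_displacement_le _)).trans ?_
    gcongr
    exact norm_rotatedHamiltonian_apply_le ε hV i j
  · rw [norm_smul, Complex.norm_real, Real.norm_eq_abs]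
    exact mul_le_of_le_one_right (abs_nonneg _) ContinuousLinearMap.norm_id_le

theorem inner_displacement_sub_apply (a b : ℝ) (φ : WeightSpace) :
    ⟪φ, displacement (b - a) φ⟫_ℂ = ⟪displacement a φ, displacement b φ⟫_ℂ := by
  rw [← inner_displacement_displacement a, ← mul_apply_eq_comp, ← displacement_add, add_sub_cancel]

theorem inner_displacementHom_excessSymbol_apply (ε : n → ℝ) (ρ V : Matrix n n ℂ)
    (φ : WeightSpace) :
    ⟪φ, displacementHom (excessSymbol ε ρ V) φ⟫_ℂ
      = ∑ i, ∑ j, rotatedHamiltonian ε V i j * ρ j i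
          * ⟪displacement (ε i) φ, displacement (ε j) φ⟫_ℂ
        - ((passiveEnergy ε ρ * ‖φ‖ ^ 2 : ℝ) : ℂ) := by
  have hself : ⟪φ, φ⟫_ℂ = ((‖φ‖ ^ 2 : ℝ) : ℂ) := by
    rw [inner_self_eq_norm_sq_to_K]
    norm_cast
  rw [displacementHom_excessSymbol]
  simp only [sub_apply, sum_apply, smul_apply, inner_sub_right, inner_sum, inner_smul_right,
    inner_displacement_sub_apply, one_apply_eq_self, hself, Complex.ofReal_mul]

theorem displacementHom_excessSymbol_isPositive (ε : n → ℝ) {ρ V : Matrix n n ℂ}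
    (hρ : ρ.IsHermitian) (hV : V ∈ Matrix.unitaryGroup n ℂ) :
    (displacementHom (excessSymbol ε ρ V)).IsPositive := by
  rw [ContinuousLinearMap.isPositive_iff_complex]
  intro φ
  have hpos : 0 ≤ ⟪φ, displacementHom (excessSymbol ε ρ V) φ⟫_ℂ := by
    rw [inner_displacementHom_excessSymbol_apply, sub_nonneg]
    exact passiveEnergy_mul_le_sum_inner ε hρ hV (sq_nonneg _) fun i => by
      rw [norm_displacement_apply]
  have hreal := Complex.nonneg_iff.1 hpos
  have hconj : ⟪displacementHom (excessSymbol ε ρ V) φ, φ⟫_ℂ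
      = ⟪φ, displacementHom (excessSymbol ε ρ V) φ⟫_ℂ := by
    rw [← inner_conj_symm, Complex.conj_eq_iff_im.2 hreal.2.symm]
  rw [hconj]
  exact ⟨Complex.conj_eq_iff_re.1 (Complex.conj_eq_iff_im.2 hreal.2.symm), hreal.1⟩

theorem exists_norm_sq_le_re_inner_excess (ε : n → ℝ) {ρ : Matrix n n ℂ} (hρ : ρ.IsHermitian)
    (hcoh : 0 < coherentErgotropy ε ρ) {L : ℝ} (hL : 0 ≤ L) :
    ∃ C, 0 < C ∧ ∀ V ∈ Matrix.unitaryGroup n ℂ, ∀ (m : ℝ) (φ : WeightSpace),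
      ‖φ‖ ^ 2 ≤ C * (⟪φ, displacementHom (excessSymbol ε ρ V) φ⟫_ℂ).re
        + 128 * (energyGaps ε).card ^ 2 * (energyMeasure φ).real (Metric.ball m L)ᶜ := by
  set M : ℝ := ∑ i, ∑ j, (∑ k, |ε k|) * ‖ρ j i‖ + |passiveEnergy ε ρ| + 1
  have hM0 : 0 < M := by positivity
  obtain ⟨C, hC, hbound⟩ := exists_norm_sq_le_re_inner_add
    (Finset.mem_insert_self 0 _ : 0 ∈ energyGaps ε) (mul_pos (inv_pos.2 hM0) hcoh) hL
  refine ⟨C * M⁻¹, by positivity, fun V hV m φ => ?_⟩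
  have h := hbound (((M⁻¹ : ℝ) : ℂ) • excessSymbol ε ρ V)
    (Finsupp.support_smul.trans (support_coeff_excessSymbol_subset ε ρ V))
    ?_ ?_ ?_ m φ
  · rwa [map_smul, smul_apply, inner_smul_right, Complex.re_ofReal_mul, ← mul_assoc] at h
  · rw [AddMonoidAlgebra.coeff_smul, Finsupp.smul_apply, norm_smul, Complex.norm_real,
      Real.norm_of_nonneg (inv_nonneg.2 hM0.le)]
    gcongr
    exact coherentErgotropy_le_norm_coeff_zero_excessSymbol ε hρ hV
  · rw [map_smul]
    exact (displacementHom_excessSymbol_isPositive ε hρ hV).smul_of_nonneg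
      (Complex.zero_le_real.2 (inv_nonneg.2 hM0.le))
  · rw [map_smul, norm_smul, Complex.norm_real, Real.norm_of_nonneg (inv_nonneg.2 hM0.le),
      inv_mul_le_one₀ hM0]
    linarith [norm_displacementHom_excessSymbol_le ε ρ hV]

end Excess

section ControlMarginal

variable {n : Type*} [Fintype n] [DecidableEq n] {ρW : WeightSpace →L[ℂ] WeightSpace}

theorem hasSum_controlMarginal_apply (ε : n → ℝ) (ρS : Matrix n n ℂ)
    (hρW : IsDensityOperator ρW) (i j : n) :
    HasSum (fun k => ρS i j * ⟪displacement (ε j) (operatorSqrt ρW (weightBasis k)),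
      displacement (ε i) (operatorSqrt ρW (weightBasis k))⟫_ℂ) (controlMarginal ε ρS ρW i j) := by
  have hHS : ∀ a, hilbertSchmidtSq weightBasis (displacement a ∘L operatorSqrt ρW) ≠ ∞ := by
    intro a
    have h : hilbertSchmidtSq weightBasis (displacement a ∘L operatorSqrt ρW) = 1 := by
      rw [← hρW.hilbertSchmidtSq_operatorSqrt]
      simp only [hilbertSchmidtSq, enorm_sq_eq_ofReal, ContinuousLinearMap.comp_apply,
        norm_displacement_apply]
    exact h.trans_ne ENNReal.one_ne_top
  have hentry : (controlOperator ε * tensor ρS ρW * star (controlOperator ε)) i j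
      = ρS i j • (displacement (ε i) * ρW * (displacement (ε j)).adjoint) := by
    rw [controlOperator, Matrix.star_eq_conjTranspose, Matrix.diagonal_conjTranspose,
      Matrix.mul_diagonal, Matrix.diagonal_mul, tensor, Matrix.of_apply, mul_smul_comm,
      smul_mul_assoc]
    rfl
  have h := (hasSum_inner_adjoint_adjoint weightBasis weightBasis (hHS (ε i))
    (hHS (ε j))).mul_left (ρS i j)
  refine (congrArg (HasSum _) ?_).mpr h
  change weightTrace ((controlOperator ε * tensor ρS ρW * star (controlOperator ε)) i j) = _
  rw [hentry, weightTrace]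
  simp only [smul_apply, inner_smul_right, tsum_mul_left, mul_apply_eq_comp,
    ContinuousLinearMap.adjoint_comp, ContinuousLinearMap.comp_apply, adjoint_operatorSqrt,
    ← inner_apply_eq_inner_operatorSqrt hρW.isPositive, ContinuousLinearMap.adjoint_inner_left]

theorem controlMarginal_apply_self (ε : n → ℝ) (ρS : Matrix n n ℂ)
    (hρW : IsDensityOperator ρW) (i : n) : controlMarginal ε ρS ρW i i = ρS i i := by
  refine (hasSum_controlMarginal_apply ε ρS hρW i i).unique ?_
  simp only [inner_displacement_displacement, ← inner_apply_eq_inner_operatorSqrt hρW.isPositive]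
  simpa using hρW.hasSum_trace.mul_left (ρS i i)

theorem hasSum_re_inner_excess (ε : n → ℝ) (ρS V : Matrix n n ℂ) (hρW : IsDensityOperator ρW) :
    HasSum (fun k => (⟪operatorSqrt ρW (weightBasis k), displacementHom (excessSymbol ε ρS V)
        (operatorSqrt ρW (weightBasis k))⟫_ℂ).re)
      (ergotropy ε ρS - ((workOperator ε V * controlMarginal ε ρS ρW).trace).re) := by
  have hexcess : HasSum (fun k => ⟪operatorSqrt ρW (weightBasis k),
      displacementHom (excessSymbol ε ρS V) (operatorSqrt ρW (weightBasis k))⟫_ℂ)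
      ((rotatedHamiltonian ε V * controlMarginal ε ρS ρW).trace
        - ((passiveEnergy ε ρS * 1 : ℝ) : ℂ)) := by
    simp only [inner_displacementHom_excessSymbol_apply, mul_assoc, Matrix.trace,
      Matrix.diag_apply, Matrix.mul_apply (M := rotatedHamiltonian ε V)]
    exact (hasSum_sum fun i _ => hasSum_sum fun j _ =>
      (hasSum_controlMarginal_apply ε ρS hρW j i).mul_left _).sub
      (Complex.hasSum_ofReal.2 (hρW.hasSum_norm_sq.mul_left _))
  have hmean : (systemHamiltonian ε * controlMarginal ε ρS ρW).trace
      = (systemHamiltonian ε * ρS).trace := by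
    simp only [Matrix.trace, Matrix.diag_apply, systemHamiltonian, Matrix.diagonal_mul,
      controlMarginal_apply_self ε ρS hρW]
  convert Complex.hasSum_re hexcess using 1
  rw [trace_workOperator_mul, hmean, passiveEnergy, Complex.sub_re, Complex.sub_re,
    Complex.ofReal_re]
  ring

theorem IsDensityOperator.isProbabilityMeasure_energyDistribution (hρW : IsDensityOperator ρW) :
    IsProbabilityMeasure (energyDistribution ρW) := by
  refine ⟨(Measure.sum_apply _ MeasurableSet.univ).trans ?_⟩
  refine (tsum_congr fun k => energyMeasure_univ _).trans ?_
  exact hρW.hilbertSchmidtSq_operatorSqrt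

theorem IsDensityOperator.hasSum_energyMeasure_real (hρW : IsDensityOperator ρW) {S : Set ℝ}
    (hS : MeasurableSet S) :
    HasSum (fun k => (energyMeasure (operatorSqrt ρW (weightBasis k))).real S)
      ((energyDistribution ρW).real S) := by
  have := hρW.isProbabilityMeasure_energyDistribution
  have happly : energyDistribution ρW S
      = ∑' k, energyMeasure (operatorSqrt ρW (weightBasis k)) S := Measure.sum_apply _ hS
  have hfinite : ∑' k, energyMeasure (operatorSqrt ρW (weightBasis k)) S ≠ ∞ :=
    happly ▸ measure_ne_top _ S
  rw [Measure.real, happly, ENNReal.tsum_toReal_eq fun k => ENNReal.ne_top_of_tsum_ne_top hfinite k]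
  exact ENNReal.hasSum_toReal hfinite

theorem exists_ergotropy_controlMarginal_add_le (ε : n → ℝ) {ρS : Matrix n n ℂ}
    (hρS : ρS.IsHermitian) (hcoh : 0 < coherentErgotropy ε ρS) :
    ∃ η : NNReal, 0 < η ∧ ∀ L : ℝ, 0 ≤ L → ∃ δ : ℝ, 0 < δ ∧
      ∀ ρW : WeightSpace →L[ℂ] WeightSpace, IsDensityOperator ρW → ∀ m : ℝ,
        energyDistribution ρW (Metric.ball m L)ᶜ ≤ η →
        ergotropy ε (controlMarginal ε ρS ρW) + δ ≤ ergotropy ε ρS := by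
  obtain ⟨d, hd⟩ : ∃ d : NNReal, d = (energyGaps ε).card := ⟨_, rfl⟩
  have hd0 : 0 < d := by
    rw [hd]
    exact Nat.cast_pos.2 (Finset.card_pos.2 (Finset.insert_nonempty 0 _))
  refine ⟨1 / (256 * d ^ 2), by positivity, fun L hL => ?_⟩
  obtain ⟨C, hC, hbound⟩ := exists_norm_sq_le_re_inner_excess ε hρS hcoh hL
  rw [← NNReal.coe_natCast, ← hd] at hbound
  refine ⟨1 / (2 * C), by positivity, fun ρW hρW m htail => ?_⟩
  rw [← le_sub_iff_add_le]
  refine ergotropy_le fun V hV => ?_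
  have hsum : 1 ≤ C * (ergotropy ε ρS - ((workOperator ε V * controlMarginal ε ρS ρW).trace).re)
      + 128 * d ^ 2 * (energyDistribution ρW).real (Metric.ball m L)ᶜ :=
    hasSum_le (fun k => hbound V hV m (operatorSqrt ρW (weightBasis k))) hρW.hasSum_norm_sq
      (((hasSum_re_inner_excess ε ρS V hρW).mul_left C).add
        ((hρW.hasSum_energyMeasure_real Metric.isOpen_ball.measurableSet.compl).mul_left _))
  have htail' : 128 * d ^ 2 * (energyDistribution ρW).real (Metric.ball m L)ᶜ ≤ 1 / 2 := by
    calc _ ≤ 128 * (d : ℝ) ^ 2 * (1 / (256 * d ^ 2) : NNReal) := by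
          gcongr
          exact ENNReal.toReal_mono ENNReal.coe_ne_top htail
      _ = 1 / 2 := by
          push_cast
          field_simp
          norm_num
  rw [le_sub_comm, div_le_iff₀ (by positivity)]
  linarith

end ControlMarginal

section Chebyshev

theorem energyDistribution_compl_ball_le (ρ : WeightSpace →L[ℂ] WeightSpace) {L : NNReal}
    (hL : L ≠ 0) :
    energyDistribution ρ (Metric.ball (∫ E, E ∂energyDistribution ρ) L)ᶜ
      ≤ (energyDispersion ρ / L) ^ 2 := by
  have hvar : energyDispersion ρ ^ 2
      = ProbabilityTheory.evariance (fun E : ℝ => E) (energyDistribution ρ) := by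
    rw [energyDispersion, ← ENNReal.rpow_natCast, ← ENNReal.rpow_mul]
    norm_num
  rw [div_eq_mul_inv, mul_pow, hvar, ← ENNReal.inv_pow, ← div_eq_mul_inv]
  convert ProbabilityTheory.meas_ge_le_evariance_div_sq (X := fun E : ℝ => E)
    (μ := energyDistribution ρ) (by fun_prop) hL using 2
  ext E
  simp [Real.dist_eq]

theorem exists_energyDistribution_compl_ball_le (C : NNReal) {η : NNReal} (hη : 0 < η) :
    ∃ L : ℝ, 0 ≤ L ∧ ∀ ρ : WeightSpace →L[ℂ] WeightSpace, energyDispersion ρ ≤ C →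
      ∃ m : ℝ, energyDistribution ρ (Metric.ball m L)ᶜ ≤ η := by
  obtain ⟨L, hL⟩ : ∃ L, L = (C + 1) / NNReal.sqrt η := ⟨_, rfl⟩
  have hL0 : L ≠ 0 := by
    rw [hL]
    positivity
  have hratio : C / L ≤ NNReal.sqrt η := by
    rw [hL, div_div_eq_mul_div, div_le_iff₀ (by positivity), mul_comm]
    gcongr
    exact le_self_add
  refine ⟨L, NNReal.coe_nonneg L, fun ρ hρ => ⟨∫ E, E ∂energyDistribution ρ, ?_⟩⟩
  calc energyDistribution ρ (Metric.ball (∫ E, E ∂energyDistribution ρ) L)ᶜ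
      ≤ (energyDispersion ρ / L) ^ 2 :=
        energyDistribution_compl_ball_le ρ hL0
    _ ≤ ((C / L : NNReal) : ℝ≥0∞) ^ 2 := by
        rw [ENNReal.coe_div hL0]
        gcongr
    _ ≤ (NNReal.sqrt η : ℝ≥0∞) ^ 2 := by gcongr
    _ = η := by rw [← ENNReal.coe_pow, NNReal.sq_sqrt]

end Chebyshev

theorem exists_ergotropy_add_le_of_energyDispersion_le {n : Type*} [Fintype n] [DecidableEq n]
    (ε : n → ℝ) {ρS : Matrix n n ℂ} (hρS : IsDensityMatrix ρS)
    (hcoh : 0 < coherentErgotropy ε ρS) (C : NNReal) :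
    ∃ δ : ℝ, 0 < δ ∧ ∀ (ρW : WeightSpace →L[ℂ] WeightSpace) (U : CompositeOperator n),
      IsDensityOperator ρW → star U * U = 1 → (∀ s, Commute U (freeEvolution ε s)) →
      energyDispersion ρW ≤ C ∨ energyDispersion (finalWeightState U ρS ρW) ≤ C →
      ergotropy ε (controlMarginal ε ρS ρW) + δ ≤ ergotropy ε ρS := by
  obtain ⟨η, hη, hgap⟩ := exists_ergotropy_controlMarginal_add_le ε hρS.posSemidef.isHermitian hcoh
  obtain ⟨L, hL, htail⟩ := exists_energyDistribution_compl_ball_le C hη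
  set D : ℝ := ∑ i, |ε i|
  have hD : ∀ i, |ε i| ≤ D := fun i =>
    Finset.single_le_sum (f := fun i => |ε i|) (fun _ _ => abs_nonneg _) (Finset.mem_univ i)
  have hD0 : 0 ≤ D := Finset.sum_nonneg fun _ _ => abs_nonneg _
  obtain ⟨δ, hδ, hloss⟩ := hgap (L + D + D) (by positivity)
  refine ⟨δ, hδ, fun ρW U hρW hU hcomm hdisp => ?_⟩
  rcases hdisp with hinitial | hfinal
  · obtain ⟨m, hm⟩ := htail ρW hinitial
    refine hloss ρW hρW m ((measure_mono (Set.compl_subset_compl.2 ?_)).trans hm)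
    exact Metric.ball_subset_ball (by linarith)
  · obtain ⟨m, hm⟩ := htail _ hfinal
    exact hloss ρW hρW m
      ((energyDistribution_le_finalWeightState hρS hρW.isPositive hU hcomm hD m L).trans hm)

end

end QuantumWeight

open QuantumWeight Filter in
theorem mainTheorem6_general {n α : Type*} [Fintype n] [DecidableEq n] (ε : n → ℝ)
    (ρS : Matrix n n ℂ) (hρS : IsDensityMatrix ρS) (hcoh : 0 < coherentErgotropy ε ρS)
    {l : Filter α} {ρW : α → WeightSpace →L[ℂ] WeightSpace} {U : α → CompositeOperator n}
    (hρW : ∀ k, IsDensityOperator (ρW k)) (hU : ∀ k, star (U k) * U k = 1)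
    (hcomm : ∀ k s, Commute (U k) (freeEvolution ε s))
    (hlim : Tendsto (fun k => ergotropy ε (controlMarginal ε ρS (ρW k))) l
      (𝓝 (ergotropy ε ρS))) :
    Tendsto (fun k => energyDispersion (ρW k)) l (𝓝 ⊤) ∧
      Tendsto (fun k => energyDispersion (finalWeightState (U k) ρS (ρW k))) l (𝓝 ⊤) := by
  have hlarge : ∀ C : NNReal, ∀ᶠ k in l, C < energyDispersion (ρW k) ∧
      C < energyDispersion (finalWeightState (U k) ρS (ρW k)) := by
    intro C
    obtain ⟨δ, hδ, hloss⟩ := exists_ergotropy_add_le_of_energyDispersion_le ε hρS hcoh C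
    filter_upwards [hlim.eventually (lt_mem_nhds (sub_lt_self _ hδ))] with k hk
    by_contra hsmall
    rw [not_and_or, not_lt, not_lt] at hsmall
    linarith [hloss (ρW k) (U k) (hρW k) (hU k) (hcomm k) hsmall]
  rw [ENNReal.tendsto_nhds_top_iff_nnreal, ENNReal.tendsto_nhds_top_iff_nnreal]
  exact ⟨fun C => (hlarge C).mono fun _ => And.left, fun C => (hlarge C).mono fun _ => And.right⟩

theorem mainTheorem6 {n : Type*} [Fintype n] [DecidableEq n] (ε : n → ℝ) (ρS : Matrix n n ℂ)
    (hρS : QuantumWeight.IsDensityMatrix ρS)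
    (hcoh : 0 < QuantumWeight.coherentErgotropy ε ρS) :
    (∀ (ρW : QuantumWeight.WeightSpace →L[ℂ] QuantumWeight.WeightSpace)
        (U : QuantumWeight.CompositeOperator n),
      QuantumWeight.IsDensityOperator ρW → QuantumWeight.IsWorkExtraction ε U →
      QuantumWeight.ergotropy ε ρS =
        QuantumWeight.ergotropy ε (QuantumWeight.controlMarginal ε ρS ρW) →
      QuantumWeight.energyDispersion ρW = ⊤ ∧
        QuantumWeight.energyDispersion (QuantumWeight.finalWeightState U ρS ρW) = ⊤) ∧
    (∀ (ρW : ℕ → QuantumWeight.WeightSpace →L[ℂ] QuantumWeight.WeightSpace)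
        (U : ℕ → QuantumWeight.CompositeOperator n),
      (∀ k, QuantumWeight.IsDensityOperator (ρW k)) →
      (∀ k, QuantumWeight.IsWorkExtraction ε (U k)) →
      Filter.Tendsto
        (fun k => QuantumWeight.ergotropy ε (QuantumWeight.controlMarginal ε ρS (ρW k)))
        Filter.atTop (𝓝 (QuantumWeight.ergotropy ε ρS)) →
      Filter.Tendsto (fun k => QuantumWeight.energyDispersion (ρW k)) Filter.atTop (𝓝 ⊤) ∧
        Filter.Tendsto
          (fun k => QuantumWeight.energyDispersion
            (QuantumWeight.finalWeightState (U k) ρS (ρW k)))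
          Filter.atTop (𝓝 ⊤)) := by
  refine ⟨fun ρW U hρW hU hR => ?_, fun ρW U hρW hU hlim => ?_⟩
  · have h := mainTheorem6_general ε ρS hρS hcoh (l := Filter.atTop (α := ℕ)) (fun _ => hρW)
      (fun _ => hU.mem_unitary.1) (fun _ => hU.energy_conserving) (hR ▸ tendsto_const_nhds)
    exact h.imp tendsto_const_nhds_iff.1 tendsto_const_nhds_iff.1
  · exact mainTheorem6_general ε ρS hρS hcoh hρW (fun k => (hU k).mem_unitary.1)
      (fun k => (hU k).energy_conserving) hlim
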